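/- Let $K$ be a number field and let $d,n$ be integers with $d>1$ and $n\ge 0$. Then there is a Zariski dense subset $\mathcal H\subseteq K^d$ (that is, no nonzero polynomial in $d$ variables over $K$ vanishes on all of $\mathcal H$) such that for every $f(x)=x^d+c_{d-1}x^{d-1}+\dots+c_1x+c_0$ with $(c_0,\dots,c_{d-1})\in\mathcal H$ one has \[\operatorname{Gal}\bigl(K\bigl((f'\circ f^n)^{-1}(0)\bigr)/K\bigr)\;\cong\; S_{d-1}\bigl[[S_d]^n\bigr].\] Here $f'$ is the derivative of $f$, $f^n$ is the $n$-th iterate of $f$ under composition ($f^0(x)=x$), and $K((f'\circ f^n)^{-1}(0))$ is the field generated over $K$ by the roots of $f'\circ f^n$ in an algebraic closure of $K$, i.e. the splitting field of $f'\circ f^n$ over $K$. For a group $G$ and $m\ge 1$, $S_m[G]=G^m\rtimes S_m$ is the wreath product in which the symmetric group $S_m$ permutes the $m$ coordinates of $G^m$; $[S_d]^0$ is the trivial group and $[S_d]^{n+1}=S_d[[S_d]^n]$. -/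

import Mathlib

/-- A subset `S` of the affine space `K ^ ι` is Zariski dense if it meets every nonempty basic
open set: no nonzero polynomial vanishes identically on `S`. (Over an infinite field `K`, the set
`{x | p(x) ≠ 0}` is nonempty exactly when `p ≠ 0`.) -/
def ZariskiDense {K ι : Type*} [Field K] (S : Set (ι → K)) : Prop :=
  ∀ p : MvPolynomial ι K, p ≠ 0 → ∃ x ∈ S, MvPolynomial.eval x p ≠ 0

/-- The permutational wreath product `S_m[G] = G ^ m ⋊ S_m`, where the symmetric group acts by
permuting the coordinates: `(σ • v) i = v (σ⁻¹ i)`. -/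
abbrev SymWreath (m : ℕ) (G : Type) [Group G] : Type :=
  SemidirectProduct (Fin m → G) (Equiv.Perm (Fin m)) mulAutArrow

/-- The iterated wreath product of the symmetric group, as a bundled group: `[S_d]^0` is
trivial and `[S_d]^(n+1) = S_d[[S_d]^n]`. -/
def iteratedSymWreath (d : ℕ) : ℕ → GrpCat.{0}
  | 0 => GrpCat.of PUnit
  | n + 1 => GrpCat.of (SymWreath d (iteratedSymWreath d n))

/-- The monic polynomial `x^d + c_{d-1} x^{d-1} + ⋯ + c_1 x + c_0`. -/
noncomputable def monicOfCoeffs {K : Type*} [Field K] {d : ℕ} (c : Fin d → K) : Polynomial K :=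
  Polynomial.X ^ d + ∑ i : Fin d, Polynomial.C (c i) * Polynomial.X ^ (i : ℕ)

/-- The polynomial `f' ∘ f^n`, where `f^n` is the `n`-th iterate of `f` under composition and
`f^0 = x`. -/
noncomputable def derivCompIterate {K : Type*} [Field K] (f : Polynomial K) (n : ℕ) :
    Polynomial K :=
  (Polynomial.derivative f).comp (f.comp^[n] Polynomial.X)

/-! The roots of `f' ∘ f^n` are the top level of a forest: its base is the set of `d - 1` critical
points, and `f` maps each level to the one below with fibres of size `d`. The wreath product is the
automorphism group of this forest, so the task is to find `f` for which Galois realizes every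
automorphism. By `exists_smul_eq_of_swap` this can be checked one layer at a time: it suffices that
Galois is transitive on the level, that a point stabilizer is transitive on the rest of its fibre,
and that some element acts on the level as a single transposition. The conjugates of that
transposition are all the transpositions inside fibres, and these generate the permutations
preserving every fibre.

All three ingredients come from inertia at primes unramified in `K`. If the constant term of a split
polynomial has `p`-adic order one, inertia is transitive on the roots reducing to zero
(`exists_mem_inertia_smul_eq`). When `f` reduces to `X ^ d`, these are all roots; when it reduces to
`X ^ (d - 1) * (X - d)`, they are all but one point of a fibre; when the reduction has one double
root at zero and is otherwise separable, they are the two points of a transposition.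

The hard point is a transposition at level `m + 1`. Take `f = F + t` with `t` complex such that the
critical point `0` has exact period `m + 1` while the other critical points escape. Then `0` is the
only multiple root of `f' ∘ f^(m+1)`, and it is double. As `t` is an algebraic integer, this
specializes to an integer parameter modulo large primes (`exists_swapAt`).

Each condition depends only on coefficients modulo the square of a prime. The Chinese remainder
theorem combines them into one residue class, which is Zariski dense. Working in `familyPoly`
ensures `f' = d * g` with `g` monic and integral. -/

open Polynomial NumberField

/-! ### Iterated wreath products as permutation groups of words. -/

section Wreath

open Equiv

variable {e : ℕ} {G : Type} [Group G] {T : Type}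

/-- The imprimitive action of a wreath product on `Fin e × T` built from an action of the base
group on `T`. -/
def wreathPermHom (ρ : G →* Perm T) : SymWreath e G →* Perm (Fin e × T) :=
  MonoidHom.toHomPerm
    { toFun := fun x p => (x.right p.1, ρ (x.left (x.right p.1)) p.2)
      map_one' := by
        funext p
        simp only [SemidirectProduct.one_left, SemidirectProduct.one_right, Pi.one_apply, map_one,
          Perm.coe_one, id_eq]
        rfl
      map_mul' := fun x y => by
        funext p
        refine Prod.ext rfl ?_
        change ρ ((x * y).left ((x * y).right p.1)) p.2 =
          ρ (x.left (x.right (y.right p.1))) (ρ (y.left (y.right p.1)) p.2)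
        rw [← Perm.mul_apply, ← map_mul]
        have h : (mulAutArrow x.right y.left : Fin e → G) (x.right (y.right p.1)) =
            y.left (y.right p.1) :=
          congrArg y.left (x.right.symm_apply_apply _)
        rw [SemidirectProduct.mul_left, SemidirectProduct.mul_right, Pi.mul_apply,
          Perm.mul_apply, h] }

@[simp]
theorem wreathPermHom_apply (ρ : G →* Perm T) (x : SymWreath e G) (p : Fin e × T) :
    wreathPermHom ρ x p = (x.right p.1, ρ (x.left (x.right p.1)) p.2) := rfl

theorem wreathPermHom_injective [Nonempty T] {ρ : G →* Perm T} (hρ : Function.Injective ρ) :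
    Function.Injective (wreathPermHom (e := e) ρ) := by
  obtain ⟨t⟩ := ‹Nonempty T›
  intro x y h
  have hp : ∀ p, wreathPermHom ρ x p = wreathPermHom ρ y p := fun p => by rw [h]
  simp only [wreathPermHom_apply, Prod.mk.injEq] at hp
  have hr : x.right = y.right := Equiv.ext fun i => (hp (i, t)).1
  refine SemidirectProduct.ext (funext fun i => hρ (Equiv.ext fun w => ?_)) hr
  have := (hp (x.right.symm i, w)).2
  rw [← hr] at this
  simpa using this

theorem mem_range_wreathPermHom {ρ : G →* Perm T} {a : Perm (Fin e × T)} :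
    a ∈ (wreathPermHom (e := e) ρ).range ↔
      ∃ (σ : Perm (Fin e)) (h : Fin e → G), ∀ i w, a (i, w) = (σ i, ρ (h i) w) := by
  constructor
  · rintro ⟨x, rfl⟩
    exact ⟨x.right, fun i => x.left (x.right i), fun i w => rfl⟩
  · rintro ⟨σ, h, H⟩
    refine ⟨⟨fun i => h (σ.symm i), σ⟩, Equiv.ext fun p => ?_⟩
    simp [H]

/-- Words of length `n` on `d` letters. -/
def Word (d : ℕ) : ℕ → Type
  | 0 => PUnit
  | n + 1 => Fin d × Word d n

instance Word.finite (d : ℕ) : ∀ n, Finite (Word d n)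
  | 0 => inferInstanceAs (Finite PUnit)
  | n + 1 => by
    have := Word.finite d n
    exact inferInstanceAs (Finite (Fin d × Word d n))

theorem Word.nonempty {d : ℕ} (hd : 0 < d) : ∀ n, Nonempty (Word d n)
  | 0 => ⟨PUnit.unit⟩
  | n + 1 => (Word.nonempty hd n).map fun w => (⟨0, hd⟩, w)

/-- Two words of length `n` agree up to their last `k` letters. -/
def Word.Agree (d : ℕ) : (n k : ℕ) → Word d n → Word d n → Prop
  | 0, _, _, _ => True
  | n + 1, k, w, v => n + 1 ≤ k ∨ (w.1 = v.1 ∧ Word.Agree d n k w.2 v.2)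

theorem Word.agree_of_le {d n k : ℕ} (h : n ≤ k) (w v : Word d n) : Word.Agree d n k w v := by
  cases n with
  | zero => trivial
  | succ n => exact Or.inl h

theorem Word.agree_succ {d n k : ℕ} (h : k ≤ n) (w v : Word d (n + 1)) :
    Word.Agree d (n + 1) k w v ↔ w.1 = v.1 ∧ Word.Agree d n k w.2 v.2 := by
  refine ⟨fun H => H.resolve_left (by omega), Or.inr⟩

/-- For `k = n` only first coordinates are compared, so the permutation acts on `Fin e`; the
remaining `k` say that each induced map between fibres lies in the range of `ρ`. -/
theorem mem_range_wreathPermHom_word {d n : ℕ} {ρ : G →* Perm (Word d n)} (hd : 0 < d)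
    (hρ : ∀ a, a ∈ ρ.range ↔ ∀ k w v, Word.Agree d n k (a w) (a v) ↔ Word.Agree d n k w v)
    (a : Perm (Fin e × Word d n)) :
    a ∈ (wreathPermHom (e := e) ρ).range ↔ ∀ k ≤ n, ∀ x y,
      ((a x).1 = (a y).1 ∧ Word.Agree d n k (a x).2 (a y).2) ↔
        (x.1 = y.1 ∧ Word.Agree d n k x.2 y.2) := by
  rw [mem_range_wreathPermHom]
  constructor
  · rintro ⟨σ, h, H⟩ k - ⟨i, w⟩ ⟨j, v⟩
    simp only [H, σ.injective.eq_iff]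
    refine and_congr_right ?_
    rintro rfl
    exact (hρ (ρ (h i))).1 ⟨_, rfl⟩ k w v
  · intro H
    obtain ⟨w₀⟩ := Word.nonempty hd n
    have hfst : ∀ x y, (a x).1 = (a y).1 ↔ x.1 = y.1 := fun x y => by
      simpa [Word.agree_of_le le_rfl] using H n le_rfl x y
    have hσ : Function.Injective fun i => (a (i, w₀)).1 := fun i j h => (hfst _ _).1 h
    have hτ : ∀ i, Function.Injective fun w => (a (i, w)).2 := fun i w v h => by
      have : a (i, w) = a (i, v) := Prod.ext ((hfst _ _).2 rfl) h
      simpa using this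
    have key : ∀ i, ∃ h : G, ∀ w, ρ h w = (a (i, w)).2 := fun i => by
      obtain ⟨h, hh⟩ := (hρ (Equiv.ofBijective _ (Finite.injective_iff_bijective.1 (hτ i)))).2 (by
        intro k w v
        rcases le_total k n with hk | hk
        · simpa [hfst] using H k hk (i, w) (i, v)
        · simp [Word.agree_of_le hk])
      exact ⟨h, fun w => by rw [hh]; rfl⟩
    choose h hh using key
    refine ⟨Equiv.ofBijective _ (Finite.injective_iff_bijective.1 hσ), h, fun i w => ?_⟩
    exact Prod.ext ((hfst _ _).2 rfl) (hh i w).symm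

/-- The iterated wreath product acts faithfully on words, as the group of all permutations
respecting common prefixes. -/
theorem exists_iteratedSymWreath_hom {d : ℕ} (hd : 0 < d) (n : ℕ) :
    ∃ ρ : iteratedSymWreath d n →* Perm (Word d n), Function.Injective ρ ∧
      ∀ a, a ∈ ρ.range ↔ ∀ k w v, Word.Agree d n k (a w) (a v) ↔ Word.Agree d n k w v := by
  induction n with
  | zero =>
    have hs : Subsingleton (Word d 0) := inferInstanceAs (Subsingleton PUnit)
    refine ⟨1, fun x y _ => ?_, fun a => ?_⟩
    · exact Subsingleton.elim (α := PUnit) x y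
    · exact ⟨fun _ _ _ _ => Iff.rfl, fun _ => ⟨1, Equiv.ext fun _ => hs.elim _ _⟩⟩
  | succ n ih =>
    obtain ⟨ρ, hinj, hρ⟩ := ih
    have := Word.nonempty hd n
    refine ⟨wreathPermHom (e := d) ρ, wreathPermHom_injective hinj, fun a => ?_⟩
    refine (mem_range_wreathPermHom_word hd hρ a).trans ⟨fun H k w v => ?_, fun H k hk x y => ?_⟩
    · rcases le_or_gt k n with hk | hk
      · rw [Word.agree_succ hk, Word.agree_succ hk]
        exact H k hk w v
      · exact iff_of_true (Word.agree_of_le hk _ _) (Word.agree_of_le hk _ _)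
    · exact (Word.agree_succ hk _ _).symm.trans ((H k x y).trans (Word.agree_succ hk _ _))

end Wreath

/-! ### Generating all automorphisms of a tower of preimages. -/

section Tower

open Equiv

/-- Multiplying `k` by `swap x (k x)`, a transposition inside a fibre, shrinks the support. -/
theorem mem_of_fiberwise_of_swap_mem {X Y : Type*} [Finite X] [DecidableEq X] (π : X → Y)
    (H : Subgroup (Perm X)) (hswap : ∀ x y, π x = π y → swap x y ∈ H) (k : Perm X)
    (hk : ∀ x, π (k x) = π x) : k ∈ H := by
  have := Fintype.ofFinite X
  induction hc : k.support.card using Nat.strong_induction_on generalizing k with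
  | _ c ih =>
    by_cases h1 : k = 1
    · exact h1 ▸ H.one_mem
    obtain ⟨x, hx⟩ : ∃ x, k x ≠ x := by
      by_contra! h
      exact h1 (Equiv.ext h)
    have hs : swap x (k x) ∈ H := hswap _ _ (hk x).symm
    have hm : swap x (k x) * k ∈ H := by
      refine ih _ (hc ▸ Perm.card_support_swap_mul hx) _ (fun y => ?_) rfl
      rw [Perm.mul_apply, swap_apply_def]
      split_ifs with h2 h3
      · rw [hk x, ← hk y, h2]
      · rw [← hk y, h3, hk x]
      · exact hk y
    simpa using H.mul_mem (H.inv_mem hs) hm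

/-- One layer of a tower of permutation representations: if `Γ` acts transitively, point
stabilizers act transitively on the remainder of some fibre, and some element acts as a
transposition, then `Γ` realizes every permutation covering the action of an element of `Γ`. -/
theorem exists_smul_eq_of_swap {Γ X Y : Type*} [Group Γ] [MulAction Γ X] [MulAction Γ Y]
    [Finite X] (π : X → Y) (hπ : ∀ (γ : Γ) x, π (γ • x) = γ • π x)
    (htrans : ∀ x y : X, ∃ γ : Γ, γ • x = y) (x₀ : X)
    (h2 : ∀ y z, π y = π x₀ → π z = π x₀ → y ≠ x₀ → z ≠ x₀ → ∃ γ : Γ, γ • x₀ = x₀ ∧ γ • y = z)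
    (hfib : ∀ x : X, ∃ y, y ≠ x ∧ π y = π x) (τ : Γ) (a b : X) (hab : a ≠ b) (hτa : τ • a = b)
    (hτb : τ • b = a) (hτ : ∀ x, x ≠ a → x ≠ b → τ • x = x)
    (β : Perm X) (γ₀ : Γ) (hβ : ∀ x, π (β x) = γ₀ • π x) : ∃ γ : Γ, ∀ x, γ • x = β x := by
  classical
  have hpair : ∀ x y x' y' : X, π x = π y → π x' = π y' → x ≠ y → x' ≠ y' →
      ∃ γ : Γ, γ • x = x' ∧ γ • y = y' := by
    intro x y x' y' h h' hne hne'
    obtain ⟨s, hs⟩ := htrans x x₀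
    obtain ⟨t, ht⟩ := htrans x' x₀
    obtain ⟨γ, hγ1, hγ2⟩ := h2 (s • y) (t • y')
      (by rw [hπ, ← h, ← hπ, hs]) (by rw [hπ, ← h', ← hπ, ht])
      (fun h => hne (smul_left_cancel s (hs.trans h.symm)))
      (fun h => hne' (smul_left_cancel t (ht.trans h.symm)))
    refine ⟨t⁻¹ * γ * s, ?_, ?_⟩
    · rw [mul_smul, mul_smul, hs, hγ1, ← ht, inv_smul_smul]
    · rw [mul_smul, mul_smul, hγ2, inv_smul_smul]
  -- A sibling `c` of `a` other than `b` is fixed by `τ`, so `τ` fixes `π c = π a`, while it sends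
  -- `π a` to `π b`.
  have hsib : π a = π b := by
    by_contra hne
    obtain ⟨c, hca, hc⟩ := hfib a
    have hcb : c ≠ b := by
      rintro rfl
      exact hne hc.symm
    apply hne
    rw [← hτa, hπ, ← hc, ← hπ, hτ c hca hcb]
  have hswap : ∀ x y, π x = π y → swap x y ∈ (MulAction.toPermHom Γ X).range := by
    intro x y hxy
    by_cases hne : x = y
    · rw [hne, swap_self]
      exact one_mem _
    obtain ⟨γ, rfl, rfl⟩ := hpair a b x y hsib hxy hab hne
    refine ⟨γ * τ * γ⁻¹, Equiv.ext fun z => ?_⟩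
    rw [MulAction.toPermHom_apply, MulAction.toPerm_apply, mul_smul, mul_smul, swap_apply_def]
    split_ifs with h1 h2
    · rw [h1, inv_smul_smul, hτa]
    · rw [h2, inv_smul_smul, hτb]
    · rw [hτ, smul_inv_smul]
      · rwa [Ne, inv_smul_eq_iff]
      · rwa [Ne, inv_smul_eq_iff]
  -- `β` and `γ₀` agree on the level below, so `γ₀⁻¹ β` preserves fibres.
  obtain ⟨γ, hγ⟩ := mem_of_fiberwise_of_swap_mem π _ hswap
    ((MulAction.toPermHom Γ X γ₀)⁻¹ * β) (fun x => by
      rw [Perm.mul_apply, ← map_inv, MulAction.toPermHom_apply, MulAction.toPerm_apply, hπ, hβ,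
        inv_smul_smul])
  refine ⟨γ₀ * γ, fun x => ?_⟩
  have := congrArg (fun k => k x) hγ
  simp only [MulAction.toPermHom_apply, MulAction.toPerm_apply, Perm.mul_apply] at this
  rw [mul_smul, this]
  exact (MulAction.toPerm γ₀ : Perm X).apply_symm_apply (β x)

/-- Glue labellings of fibres of `φ^[n]` into a labelling of the preimage of a labelled set. -/
theorem exists_word_equiv_of_fibers {A : Type*} (φ : A → A) {d e n : ℕ} {B : Set A}
    (ε : Fin e ≃ B)
    (l : ∀ i, ∃ l : Word d n ≃ {x // φ^[n] x = ε i},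
      ∀ k w v, φ^[k] (l w) = φ^[k] (l v) ↔ Word.Agree d n k w v) :
    ∃ l : Fin e × Word d n ≃ {x // φ^[n] x ∈ B}, ∀ k ≤ n, ∀ p q,
      φ^[k] (l p) = φ^[k] (l q) ↔ p.1 = q.1 ∧ Word.Agree d n k p.2 q.2 := by
  choose l hl using l
  let L : Fin e × Word d n → {x // φ^[n] x ∈ B} := fun p =>
    ⟨l p.1 p.2, by rw [(l p.1 p.2).2]; exact (ε p.1).2⟩
  have hL : ∀ k ≤ n, ∀ p q, φ^[k] (L p) = φ^[k] (L q) ↔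
      p.1 = q.1 ∧ Word.Agree d n k p.2 q.2 := by
    rintro k hk ⟨i, w⟩ ⟨j, v⟩
    constructor
    · intro h
      have h1 : φ^[n] (L (i, w)) = φ^[n] (L (j, v)) := by
        have hn : φ^[n] = φ^[n - k] ∘ φ^[k] := by
          rw [← Function.iterate_add, Nat.sub_add_cancel hk]
        simp only [hn, Function.comp_apply, h]
      have hij : i = j := by
        apply ε.injective
        apply Subtype.ext
        rw [← (l i w).2, ← (l j v).2]
        exact h1
      subst hij
      exact ⟨rfl, (hl i k w v).1 h⟩
    · rintro ⟨h, h'⟩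
      dsimp only at h h'
      subst h
      exact (hl i k w v).2 h'
  refine ⟨Equiv.ofBijective L ⟨fun p q h => ?_, fun x => ?_⟩, hL⟩
  · obtain ⟨i, w⟩ := p
    obtain ⟨j, v⟩ := q
    obtain ⟨h1, -⟩ := (hL 0 (Nat.zero_le _) (i, w) (j, v)).1 (by rw [h])
    dsimp only at h1
    subst h1
    have : l i w = l i v := Subtype.ext (congrArg (fun z : {x // φ^[n] x ∈ B} => (z : A)) h)
    rw [(l i).injective this]
  · have hx : φ^[n] x = ε (ε.symm ⟨_, x.2⟩) := by simp
    refine ⟨(ε.symm ⟨_, x.2⟩, (l _).symm ⟨x, hx⟩), Subtype.ext ?_⟩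
    simp [L]

/-- The first letter of a word names the ancestor next to `β`; applying `φ` forgets the last letter.
-/
theorem exists_word_equiv {A : Type*} (φ : A → A) {d : ℕ} (n : ℕ) (β : A)
    (hfib : ∀ j < n, ∀ x, φ^[j] x = β → Nonempty (Fin d ≃ {y // φ y = x})) :
    ∃ l : Word d n ≃ {x // φ^[n] x = β},
      ∀ k w v, φ^[k] (l w) = φ^[k] (l v) ↔ Word.Agree d n k w v := by
  induction n generalizing β with
  | zero =>
    refine ⟨⟨fun _ => ⟨β, rfl⟩, fun _ => PUnit.unit, fun _ => rfl, fun x => Subtype.ext x.2.symm⟩,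
      fun k w v => iff_of_true rfl trivial⟩
  | succ n ih =>
    obtain ⟨ε⟩ := hfib 0 (Nat.succ_pos n) β rfl
    obtain ⟨l, hl⟩ := exists_word_equiv_of_fibers φ (d := d) (n := n) (B := {y | φ y = β}) ε
      (fun i => ih (ε i) fun j hj x hx => hfib (j + 1) (by omega) x (by
        rw [Function.iterate_succ_apply', hx]; exact (ε i).2))
    refine ⟨l.trans (Equiv.subtypeEquivRight fun x => by
      rw [Function.iterate_succ_apply']; rfl), fun k w v => ?_⟩
    rcases le_or_gt k n with hk | hk
    · rw [Word.agree_succ hk]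
      exact hl k hk w v
    · refine iff_of_true ?_ (Word.agree_of_le hk _ _)
      have : ∀ x : {x // φ^[n + 1] x = β}, φ^[k] x = φ^[k - (n + 1)] β := fun x => by
        conv_lhs => rw [← Nat.sub_add_cancel hk, Function.iterate_add_apply, x.2]
      rw [this, this]

/-- The preimage of an invariant set under an iterate of an equivariant map. -/
def iteratePreimage {Γ A : Type*} [Group Γ] [MulAction Γ A] (φ : A → A)
    (hφ : ∀ (γ : Γ) x, φ (γ • x) = γ • φ x) (R : Set A) (hR : ∀ (γ : Γ), ∀ x ∈ R, γ • x ∈ R)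
    (m : ℕ) : SubMulAction Γ A where
  carrier := {x | φ^[m] x ∈ R}
  smul_mem' γ x hx := by
    have h : φ^[m] (γ • x) = γ • φ^[m] x := (Function.Semiconj.iterate_right (f := (γ • ·))
      (ga := φ) (gb := φ) (fun y => (hφ γ y).symm) m x).symm
    rw [Set.mem_ofPred_eq, h]
    exact hR γ _ hx

/-- A group acting on the tower of preimages `φ^[m] x ∈ R` whose action is transitive on each
level, doubly transitive on fibres, and contains a transposition of each level realizes all
permutations compatible with the tower. -/
theorem exists_smul_eq_of_compatible {Γ A : Type*} [Group Γ] [MulAction Γ A] {φ : A → A}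
    (hφ : ∀ (γ : Γ) x, φ (γ • x) = γ • φ x) {R : Set A} (hR : ∀ (γ : Γ), ∀ x ∈ R, γ • x ∈ R)
    {d e n : ℕ} (hd : 2 ≤ d) (ε : Fin e ≃ R)
    (hfib : ∀ m < n, ∀ x, φ^[m] x ∈ R → Nonempty (Fin d ≃ {y // φ y = x}))
    (htrans : ∀ m ≤ n, ∀ x y, φ^[m] x ∈ R → φ^[m] y ∈ R → ∃ γ : Γ, γ • x = y)
    (h2base : 2 ≤ e → ∃ x₀ ∈ R, ∀ y ∈ R, ∀ z ∈ R, y ≠ x₀ → z ≠ x₀ →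
      ∃ γ : Γ, γ • x₀ = x₀ ∧ γ • y = z)
    (h2 : ∀ m < n, ∃ x₀, φ^[m + 1] x₀ ∈ R ∧ ∀ y z, φ y = φ x₀ → φ z = φ x₀ → y ≠ x₀ → z ≠ x₀ →
      ∃ γ : Γ, γ • x₀ = x₀ ∧ γ • y = z)
    (hswap : ∀ m ≤ n, (m = 0 → 2 ≤ e) → ∃ (τ : Γ) (a b : A), a ≠ b ∧ φ^[m] a ∈ R ∧ φ^[m] b ∈ R ∧
      τ • a = b ∧ τ • b = a ∧ ∀ x, φ^[m] x ∈ R → x ≠ a → x ≠ b → τ • x = x)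
    (m : ℕ) (hm : m ≤ n) (a : Perm (iteratePreimage φ hφ R hR m))
    (ha : ∀ k ≤ m, ∀ x y, φ^[k] (a x : A) = φ^[k] (a y : A) ↔ φ^[k] (x : A) = φ^[k] (y : A)) :
    ∃ γ : Γ, ∀ x, γ • x = a x := by
  have hfin : ∀ m ≤ n, Finite (iteratePreimage φ hφ R hR m) := fun m hm => by
    obtain ⟨l, -⟩ := exists_word_equiv_of_fibers φ (d := d) (n := m) ε (fun i =>
      exists_word_equiv φ m (ε i) fun j hj x hx => hfib j (by omega) x (by rw [hx]; exact (ε i).2))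
    exact Finite.of_equiv _ l
  induction m with
  | zero =>
    rcases lt_or_ge e 2 with he | he
    · refine ⟨1, fun x => ?_⟩
      have : Subsingleton (Fin e) := Fin.subsingleton_iff_le_one.2 (by omega)
      have hs : Subsingleton R := ε.symm.subsingleton
      rw [one_smul]
      exact Subtype.ext (congrArg Subtype.val (hs.elim (⟨x.1, x.2⟩ : R) ⟨(a x).1, (a x).2⟩))
    · obtain ⟨x₀, hx₀, H⟩ := h2base he
      obtain ⟨τ, s, t, hst, hs, ht, hτs, hτt, hτ⟩ := hswap 0 hm fun _ => he
      have := hfin 0 hm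
      -- The base level is treated as a single fibre over a point.
      let _ : MulAction Γ PUnit.{1} :=
        { smul := fun _ x => x
          one_smul := fun _ => rfl
          mul_smul := fun _ _ _ => rfl }
      refine exists_smul_eq_of_swap (Γ := Γ) (X := iteratePreimage φ hφ R hR 0)
        (fun _ => PUnit.unit.{1}) (fun _ _ => rfl) ?_ ⟨x₀, hx₀⟩ ?_ ?_ τ ⟨s, hs⟩ ⟨t, ht⟩
        (fun h => hst (Subtype.ext_iff.1 h)) (Subtype.ext hτs) (Subtype.ext hτt) ?_ a 1
        (fun _ => rfl)
      · intro x y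
        obtain ⟨γ, h⟩ := htrans 0 hm x y x.2 y.2
        exact ⟨γ, Subtype.ext h⟩
      · intro y z _ _ hy hz
        obtain ⟨γ, h, h'⟩ := H y y.2 z z.2 (fun h => hy (Subtype.ext h))
          (fun h => hz (Subtype.ext h))
        exact ⟨γ, Subtype.ext h, Subtype.ext h'⟩
      · intro x
        have : Nontrivial (Fin e) := Fin.nontrivial_iff_two_le.2 he
        have : Nontrivial R := ε.symm.nontrivial
        obtain ⟨y, hy⟩ := exists_ne (⟨x, x.2⟩ : R)
        exact ⟨⟨y, y.2⟩, fun h => hy (Subtype.ext (Subtype.ext_iff.1 h)), rfl⟩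
      · intro x hxs hxt
        exact Subtype.ext (hτ x x.2 (fun h => hxs (Subtype.ext h)) fun h => hxt (Subtype.ext h))
  | succ m ih =>
    let π : iteratePreimage φ hφ R hR (m + 1) → iteratePreimage φ hφ R hR m :=
      fun x => ⟨φ x, x.2⟩
    have hπ : Function.Surjective π := fun x => by
      obtain ⟨ζ⟩ := hfib m hm x x.2
      have hy := (ζ ⟨0, by omega⟩).2
      refine ⟨⟨ζ ⟨0, by omega⟩, ?_⟩, Subtype.ext hy⟩
      change φ^[m] (φ _) ∈ R
      rw [hy]
      exact x.2
    obtain ⟨ι, hι⟩ := hπ.hasRightInverse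
    -- Compatibility for `k = 1` makes `a` descend to a permutation `b` of the level below, to which
    -- induction applies.
    have hb : ∀ x y, π (a x) = π (a y) ↔ π x = π y := fun x y => by
      rw [Subtype.ext_iff, Subtype.ext_iff]
      exact ha 1 (by omega) x y
    have := hfin m (by omega)
    have := hfin (m + 1) hm
    have hbinj : Function.Injective fun x => π (a (ι x)) := fun x y h => by
      have := (hb _ _).1 h
      rwa [hι, hι] at this
    let b : Perm (iteratePreimage φ hφ R hR m) :=
      Equiv.ofBijective _ (Finite.injective_iff_bijective.1 hbinj)
    have hbπ : ∀ x, b (π x) = π (a x) := fun x => (hb _ _).2 (hι _)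
    obtain ⟨γ₀, hγ₀⟩ := ih (by omega) b (by
      intro k hk x y
      obtain ⟨x, rfl⟩ := hπ x
      obtain ⟨y, rfl⟩ := hπ y
      rw [hbπ, hbπ]
      exact ha (k + 1) (by omega) x y)
    obtain ⟨x₀, hx₀, H⟩ := h2 m hm
    obtain ⟨τ, s, t, hst, hs, ht, hτs, hτt, hτ⟩ := hswap (m + 1) hm (by omega)
    refine exists_smul_eq_of_swap π (fun γ x => Subtype.ext (hφ γ x)) ?_ ⟨x₀, hx₀⟩ ?_ ?_ τ
      ⟨s, hs⟩ ⟨t, ht⟩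
        (fun h => hst (Subtype.ext_iff.1 h)) (Subtype.ext hτs) (Subtype.ext hτt) ?_ a γ₀
        (fun x => by rw [hγ₀, hbπ])
    · intro x y
      obtain ⟨γ, h⟩ := htrans (m + 1) hm x y x.2 y.2
      exact ⟨γ, Subtype.ext h⟩
    · intro y z hy' hz' hy hz
      obtain ⟨γ, h, h'⟩ := H y z (Subtype.ext_iff.1 hy') (Subtype.ext_iff.1 hz')
        (fun h => hy (Subtype.ext h)) (fun h => hz (Subtype.ext h))
      exact ⟨γ, Subtype.ext h, Subtype.ext h'⟩
    · intro x
      obtain ⟨ζ⟩ := hfib m hm (φ x) x.2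
      have : Nontrivial (Fin d) := Fin.nontrivial_iff_two_le.2 hd
      have : Nontrivial {y // φ y = φ x} := ζ.symm.nontrivial
      obtain ⟨y, hy⟩ := exists_ne (⟨x, rfl⟩ : {y // φ y = φ x})
      refine ⟨⟨y, ?_⟩, fun h => hy (Subtype.ext (congrArg
        (fun z : iteratePreimage φ hφ R hR (m + 1) => (z : A)) h)), Subtype.ext y.2⟩
      change φ^[m] (φ y) ∈ R
      rw [y.2]
      exact x.2
    · intro x hxs hxt
      exact Subtype.ext (hτ x x.2 (fun h => hxs (Subtype.ext h)) fun h => hxt (Subtype.ext h))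

/-- Under the hypotheses of `exists_smul_eq_of_compatible`, a group acting faithfully on the last
level is an iterated wreath product of symmetric groups. -/
theorem nonempty_mulEquiv_symWreath {Γ A : Type*} [Group Γ] [MulAction Γ A] {φ : A → A}
    (hφ : ∀ (γ : Γ) x, φ (γ • x) = γ • φ x) {R : Set A} (hR : ∀ (γ : Γ), ∀ x ∈ R, γ • x ∈ R)
    {d e n : ℕ} (hd : 2 ≤ d) (ε : Fin e ≃ R)
    (hfib : ∀ m < n, ∀ x, φ^[m] x ∈ R → Nonempty (Fin d ≃ {y // φ y = x}))
    (htrans : ∀ m ≤ n, ∀ x y, φ^[m] x ∈ R → φ^[m] y ∈ R → ∃ γ : Γ, γ • x = y)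
    (h2base : 2 ≤ e → ∃ x₀ ∈ R, ∀ y ∈ R, ∀ z ∈ R, y ≠ x₀ → z ≠ x₀ →
      ∃ γ : Γ, γ • x₀ = x₀ ∧ γ • y = z)
    (h2 : ∀ m < n, ∃ x₀, φ^[m + 1] x₀ ∈ R ∧ ∀ y z, φ y = φ x₀ → φ z = φ x₀ → y ≠ x₀ → z ≠ x₀ →
      ∃ γ : Γ, γ • x₀ = x₀ ∧ γ • y = z)
    (hswap : ∀ m ≤ n, (m = 0 → 2 ≤ e) → ∃ (τ : Γ) (a b : A), a ≠ b ∧ φ^[m] a ∈ R ∧ φ^[m] b ∈ R ∧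
      τ • a = b ∧ τ • b = a ∧ ∀ x, φ^[m] x ∈ R → x ≠ a → x ≠ b → τ • x = x)
    (hfaith : ∀ γ : Γ, (∀ x, φ^[n] x ∈ R → γ • x = x) → γ = 1) :
    Nonempty (Γ ≃* SymWreath e (iteratedSymWreath d n)) := by
  obtain ⟨l, hl⟩ := exists_word_equiv_of_fibers φ (d := d) (n := n) ε (fun i =>
    exists_word_equiv φ n (ε i) fun j hj x hx => hfib j hj x (by rw [hx]; exact (ε i).2))
  obtain ⟨ρ, hρinj, hρ⟩ := exists_iteratedSymWreath_hom (d := d) (by omega) n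
  have := Word.nonempty (d := d) (by omega) n
  let X := iteratePreimage φ hφ R hR n
  let l' : X ≃ Fin e × Word d n := l.symm
  let T : Γ →* Perm (Fin e × Word d n) :=
    (l'.permCongrHom.toMonoidHom).comp (MulAction.toPermHom Γ X)
  have hT : ∀ γ p, T γ p = l' (γ • l'.symm p) := fun γ p => rfl
  have hl' : ∀ k ≤ n, ∀ x y : X, φ^[k] (x : A) = φ^[k] (y : A) ↔
      (l' x).1 = (l' y).1 ∧ Word.Agree d n k (l' x).2 (l' y).2 := fun k hk x y => by
    rw [← hl k hk (l' x) (l' y)]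
    have h : ∀ x : X, (l (l' x) : A) = x := fun x =>
      congrArg Subtype.val (l.apply_symm_apply ⟨x, x.2⟩)
    rw [h, h]
  have hTinj : Function.Injective T := by
    rw [injective_iff_map_eq_one]
    intro γ h
    refine hfaith γ fun x hx => ?_
    have h1 := hT γ (l' ⟨x, hx⟩)
    rw [h, l'.symm_apply_apply, Perm.one_apply, l'.apply_eq_iff_eq] at h1
    exact (Subtype.ext_iff.1 h1).symm
  have hiter : ∀ k (γ : Γ) x, φ^[k] (γ • x) = γ • φ^[k] x := fun k γ x =>
    (Function.Semiconj.iterate_right (f := (γ • ·))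
      (ga := φ) (gb := φ) (fun y => (hφ γ y).symm) k x).symm
  have hrange : T.range = (wreathPermHom (e := e) ρ).range := by
    ext a
    rw [mem_range_wreathPermHom_word (by omega) hρ a]
    constructor
    · rintro ⟨γ, rfl⟩ k hk p q
      rw [hT, hT, ← hl' k hk]
      have h2 := hl' k hk (l'.symm p) (l'.symm q)
      simp only [l'.apply_symm_apply] at h2
      rw [← h2, SubMulAction.val_smul, SubMulAction.val_smul, hiter, hiter, smul_left_cancel_iff]
    · intro H
      obtain ⟨γ, hγ⟩ := exists_smul_eq_of_compatible hφ hR hd ε hfib htrans h2base h2 hswap n le_rfl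
        (l'.symm.permCongr a) (by
          intro k hk x y
          rw [hl' k hk, hl' k hk]
          simpa using H k hk (l' x) (l' y))
      refine ⟨γ, Equiv.ext fun p => ?_⟩
      rw [hT, hγ]
      simp
  exact ⟨(MonoidHom.ofInjective hTinj).trans ((MulEquiv.subgroupCongr hrange).trans
    (MonoidHom.ofInjective (wreathPermHom_injective hρinj)).symm)⟩

end Tower

/-! ### Reduction of split integral polynomials modulo a prime. -/

section Reduction

variable {A : Type*} [CommRing A] {h : ℤ[X]} {S : Finset A}

theorem mem_iff_aeval_eq_zero_of_map_eq_prod [IsDomain A]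
    (hS : h.map (Int.castRingHom A) = ∏ r ∈ S, (X - C r)) (z : A) : z ∈ S ↔ aeval z h = 0 := by
  rw [aeval_def, ← eval_map, algebraMap_int_eq, hS, eval_prod, Finset.prod_eq_zero_iff]
  simp [sub_eq_zero]

/-- Two distinct roots with the same reduction give a multiple root of the reduction. -/
theorem eval_derivative_prod_mem {P : Ideal A} {r s c : A} (hr : r ∈ S) (hs : s ∈ S)
    (hrs : r ≠ s) (hrc : c - r ∈ P) (hsc : c - s ∈ P) :
    (derivative (∏ r ∈ S, (X - C r))).eval c ∈ P := by
  classical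
  rw [← Finset.mul_prod_erase S _ hr,
    ← Finset.mul_prod_erase (S.erase r) _ (Finset.mem_erase.2 ⟨hrs.symm, hs⟩)]
  simp only [derivative_mul, derivative_X_sub_C, one_mul, eval_add, eval_mul, eval_sub, eval_X,
    eval_C]
  exact P.add_mem (P.mul_mem_right _ hsc) (P.mul_mem_right _ hrc)

theorem exists_mem_of_eval_prod_mem {P : Ideal A} [P.IsPrime] {c : A}
    (h : (∏ r ∈ S, (X - C r)).eval c ∈ P) : ∃ r ∈ S, c - r ∈ P := by
  rw [eval_prod] at h
  obtain ⟨r, hr, h⟩ := (Ideal.IsPrime.prod_mem_iff).1 h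
  exact ⟨r, hr, by simpa using h⟩

/-- If the reduction of a split polynomial is `X ^ 2` times a separable polynomial not vanishing
at zero, then exactly two roots reduce to zero and the other roots have distinct reductions. -/
theorem exists_pair_of_map_eq_X_sq_mul {p : ℕ} [Fact p.Prime] (P : Ideal A) [P.IsPrime]
    (hpP : (p : A) ∈ P) (hS : h.map (Int.castRingHom A) = ∏ r ∈ S, (X - C r))
    {Ψ : (ZMod p)[X]} (hh : h.map (Int.castRingHom (ZMod p)) = X ^ 2 * Ψ) (hsep : Ψ.Separable)
    (h0 : Ψ.eval 0 ≠ 0) :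
    ∃ a ∈ S, ∃ b ∈ S, a ≠ b ∧ a ∈ P ∧ b ∈ P ∧ (∀ c ∈ S, c ∈ P → c = a ∨ c = b) ∧
      ∀ r ∈ S, ∀ s ∈ S, r ∉ P → r - s ∈ P → r = s := by
  classical
  have : CharP (A ⧸ P) p := by
    have : ((p : ℕ) : A ⧸ P) = 0 := by
      rw [← map_natCast (Ideal.Quotient.mk P)]
      exact Ideal.Quotient.eq_zero_iff_mem.2 hpP
    exact (CharP.charP_iff_prime_eq_zero Fact.out).2 this
  let ψ : ZMod p →+* A ⧸ P := ZMod.castHom dvd_rfl (A ⧸ P)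
  let q := Ideal.Quotient.mk P
  have hq : ∀ x, q x = 0 ↔ x ∈ P := fun x => Ideal.Quotient.eq_zero_iff_mem
  set Φ := Ψ.map ψ with hΦ
  have hΦ0 : Φ.eval 0 ≠ 0 := by
    have : Φ.eval 0 = ψ (Ψ.eval 0) := by rw [hΦ, eval_zero_map]
    rw [this]
    exact (map_ne_zero ψ).2 h0
  have hΦsep : Φ.Separable := hsep.map
  have hred : (∏ r ∈ S, (X - C r)).map q = X ^ 2 * Φ := by
    rw [← hS, map_map, hΦ]
    have := congrArg (fun F => F.map ψ) hh
    simp only [Polynomial.map_mul, Polynomial.map_pow, map_X, map_map] at this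
    rw [← this]
    congr 1
    exact RingHom.ext_int _ _
  have hfac : ∀ T : Finset A, (∏ r ∈ T, (X - C r)).map q = ∏ r ∈ T, (X - C (q r)) := fun T => by
    simp [Polynomial.map_prod]
  have heval : ∀ T : Finset A, ∀ c, (∏ r ∈ T, (X - C (q r))).eval (q c) = 0 →
      ∃ r ∈ T, c - r ∈ P := fun T c hc => by
    rw [eval_prod, Finset.prod_eq_zero_iff] at hc
    obtain ⟨r, hr, h⟩ := hc
    exact ⟨r, hr, (hq _).1 (by simpa using h)⟩
  -- The two factors `X` are cancelled against one root each; the remaining roots have product `Φ`.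
  rw [hfac] at hred
  obtain ⟨a, ha, haP⟩ := heval S 0 (by simp [hred])
  have haP : a ∈ P := by simpa using haP
  have hqa : q a = 0 := (hq a).2 haP
  have hred1 : ∏ r ∈ S.erase a, (X - C (q r)) = X * Φ := by
    rw [← Finset.mul_prod_erase S _ ha, hqa, map_zero, sub_zero, pow_two, mul_assoc] at hred
    exact mul_left_cancel₀ X_ne_zero hred
  obtain ⟨b, hb, hbP⟩ := heval (S.erase a) 0 (by simp [hred1])
  have hbP : b ∈ P := by simpa using hbP
  have hqb : q b = 0 := (hq b).2 hbP
  have hred2 : ∏ r ∈ (S.erase a).erase b, (X - C (q r)) = Φ := by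
    rw [← Finset.mul_prod_erase _ _ hb, hqb, map_zero, sub_zero] at hred1
    exact mul_left_cancel₀ X_ne_zero hred1
  refine ⟨a, ha, b, Finset.mem_of_mem_erase hb, (Finset.ne_of_mem_erase hb).symm, haP, hbP,
    fun c hc hcP => ?_, fun r hr s hs hrP hrs => ?_⟩
  · by_contra! hne
    apply hΦ0
    rw [← hred2, eval_prod]
    refine Finset.prod_eq_zero (i := c) (by simp [hc, hne]) ?_
    simp [(hq c).2 hcP]
  · by_contra hne
    have hsP : s ∉ P := fun h => hrP (by simpa using P.add_mem hrs h)
    have hmem : ∀ t ∈ S, t ∉ P → t ∈ (S.erase a).erase b := fun t ht htP => by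
      simp only [Finset.mem_erase]
      exact ⟨fun h => htP (h ▸ hbP), fun h => htP (h ▸ haP), ht⟩
    have hqrs : q r = q s := Ideal.Quotient.eq.2 hrs
    -- Equal reductions outside `P` would produce a square factor of the separable `Φ`.
    have hdvd : (X - C (q r)) * (X - C (q r)) ∣ Φ := by
      rw [← hred2, ← Finset.mul_prod_erase _ _ (hmem r hr hrP), ← Finset.mul_prod_erase _ _
        (Finset.mem_erase.2 ⟨Ne.symm hne, hmem s hs hsP⟩), ← hqrs, ← mul_assoc]
      exact dvd_mul_right _ _
    have := hΦsep.squarefree _ hdvd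
    exact not_isUnit_X_sub_C _ this

theorem smul_mem_of_map_eq_prod {K L : Type*} [Field K] [Field L] [Algebra K L] {h : ℤ[X]} {S : Finset (𝓞 L)}
    (hS : h.map (Int.castRingHom (𝓞 L)) = ∏ r ∈ S, (X - C r)) (σ : Gal(L/K)) {z : 𝓞 L}
    (hz : z ∈ S) : σ • z ∈ S := by
  rw [mem_iff_aeval_eq_zero_of_map_eq_prod hS] at hz ⊢
  have := aeval_algHom_apply (MulSemiringAction.toAlgHom ℤ (𝓞 L) σ) z h
  rw [hz, map_zero] at this
  exact this

end Reduction

/-! ### Transitivity of inertia and transpositions. -/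

section Inertia

variable {K L : Type*} [Field K] [Field L] [NumberField K] [NumberField L] [Algebra K L]

/-- The inertia group at `P` is as large as the ramification index over the inertia field. -/
theorem mem_pow_ramificationIdx_of_inertia_fixed [IsGalois K L] (P : Ideal (𝓞 L)) [P.IsPrime] (hP : P ≠ ⊥)
    {x : 𝓞 L} (hx : x ∈ P) (hfix : ∀ σ ∈ P.inertia Gal(L/K), σ • x = x) :
    x ∈ P ^ P.ramificationIdx (𝓞 K) := by
  set H := P.inertia Gal(L/K) with hH
  -- `E` is the inertia field. All of `H` is inertia for `P` over `E`, so both ramification indices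
  -- equal the order of `H`. An element of `P` coming from `𝓞 E` lies in `pE`, whose extension is
  -- contained in `P ^ e`.
  let E : IntermediateField K L := FixedPoints.intermediateField H
  have hG : IsGaloisGroup H E L := IsGaloisGroup.subgroup Gal(L/K) K L H
  have hdist : SMulDistribClass H (𝓞 L) L :=
    ⟨fun σ a b => smul_distrib_smul (σ : Gal(L/K)) a b⟩
  have hGO : IsGaloisGroup H (𝓞 E) (𝓞 L) := IsGaloisGroup.of_isFractionRing H (𝓞 E) (𝓞 L) E L
  have hmaxP : P.IsMaximal := Ring.DimensionLEOne.maximalOfPrime hP inferInstance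
  let pE := P.under (𝓞 E)
  let pK := P.under (𝓞 K)
  have hpE : pE ≠ ⊥ := Ideal.under_ne_bot _ hP
  have hpK : pK ≠ ⊥ := Ideal.under_ne_bot _ hP
  have : pE.IsMaximal := Ideal.IsMaximal.under _ P
  have : pK.IsMaximal := Ideal.IsMaximal.under _ P
  have : Finite (𝓞 E ⧸ pE) := Ring.HasFiniteQuotients.finiteQuotient hpE
  have : Finite (𝓞 K ⧸ pK) := Ring.HasFiniteQuotients.finiteQuotient hpK
  have h1 : Nat.card (P.inertia Gal(L/K)) = P.ramificationIdx (𝓞 K) := by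
    rw [Ideal.card_inertia_eq_ramificationIdxIn pK P,
      Ideal.ramificationIdxIn_eq_ramificationIdx pK P Gal(L/K)]
  have h2 : Nat.card (P.inertia H) = P.ramificationIdx (𝓞 E) := by
    rw [Ideal.card_inertia_eq_ramificationIdxIn pE P,
      Ideal.ramificationIdxIn_eq_ramificationIdx pE P H]
  have h3 : P.inertia H = ⊤ := by
    refine eq_top_iff.2 fun σ _ => ?_
    exact Ideal.coe_mem_inertia.1 σ.2
  have h4 : P.ramificationIdx (𝓞 E) = P.ramificationIdx (𝓞 K) := by
    rw [← h1, ← h2, h3, Nat.card_congr Subgroup.topEquiv.toEquiv]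
  obtain ⟨y, rfl⟩ := Algebra.IsInvariant.isInvariant (A := 𝓞 E) (B := 𝓞 L) (G := H) x
    (fun σ => hfix σ σ.2)
  have hy : y ∈ pE := hx
  have h5 := Ideal.le_pow_ramificationIdx' (p := pE) (P := P)
  rw [Ideal.ramificationIdx'_eq_ramificationIdx _ _ hpE, h4] at h5
  exact h5 (Ideal.mem_map_of_mem _ hy)

/-- A rational prime unramified in `K` has `P`-adic order equal to the ramification index of `P`
over `K`. -/
theorem natCast_notMem_pow_ramificationIdx_succ {p : ℕ} (hp : p.Prime) (hdisc : ¬ (p : ℤ) ∣ discr K)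
    (P : Ideal (𝓞 L)) [P.IsPrime] (hpP : (p : 𝓞 L) ∈ P) :
    (p : 𝓞 L) ∉ P ^ (P.ramificationIdx (𝓞 K) + 1) := by
  have hpz : Prime (p : ℤ) := Nat.prime_iff_prime_int.1 hp
  have hP : P ≠ ⊥ := by
    rintro rfl
    exact hp.ne_zero (by simpa using hpP)
  have hlies : P.LiesOver (Ideal.span {(p : ℤ)}) :=
    (Ideal.liesOver_span_iff (Ideal.IsPrime.ne_top inferInstance) hpz).2 (by simpa using hpP)
  have hun : Algebra.IsUnramifiedAt ℤ (P.under (𝓞 K)) :=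
    (not_dvd_discr_iff_forall_mem K (𝓞 K) hpz).1 hdisc (P.under (𝓞 K)) inferInstance
      (by simpa [Ideal.mem_comap] using hpP)
  have h1 : P.ramificationIdx ℤ = P.ramificationIdx (𝓞 K) := by
    rw [Ideal.ramificationIdx_tower (R := ℤ) (P.under (𝓞 K)) P, Ideal.ramificationIdx_eq_one,
      one_mul]
  have hp0 : Ideal.span {(p : ℤ)} ≠ ⊥ := by simpa using hp.ne_zero
  intro hmem
  have h2 : Ideal.map (algebraMap ℤ (𝓞 L)) (Ideal.span {(p : ℤ)}) ≤
      P ^ (P.ramificationIdx (𝓞 K) + 1) := by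
    rw [Ideal.map_span, Ideal.span_le]
    simpa using hmem
  rw [← h1, ← Ideal.ramificationIdx'_eq_ramificationIdx (Ideal.span {(p : ℤ)}) P hp0] at h2
  have h3 : ∀ k, Ideal.map (algebraMap ℤ (𝓞 L)) (Ideal.span {(p : ℤ)}) ≤ P ^ k →
      k ≤ Ideal.ramificationIdx' (Ideal.span {(p : ℤ)}) P := by
    intro k hk
    rw [Ideal.IsDedekindDomain.ramificationIdx'_eq_multiplicity
      (Ideal.map_ne_bot_of_ne_bot hp0) inferInstance]
    refine (FiniteMultiplicity.of_not_isUnit ?_ ?_).le_multiplicity_of_pow_dvd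
      (Ideal.dvd_iff_le.2 hk)
    · rw [Ideal.isUnit_iff]; exact Ideal.IsPrime.ne_top inferInstance
    · exact Ideal.map_ne_bot_of_ne_bot hp0
  have := h3 _ h2
  omega

/-- `p` is no unit in `𝓞 L`, since its norm to `ℚ` is a positive power of `p`. -/
theorem exists_isPrime_natCast_mem {p : ℕ} (hp : p.Prime) :
    ∃ P : Ideal (𝓞 L), P.IsPrime ∧ (p : 𝓞 L) ∈ P := by
  have hnu : ¬ IsUnit (p : 𝓞 L) := by
    intro hu
    have h1 := hu.map (RingOfIntegers.norm ℚ)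
    rw [← map_natCast (algebraMap (𝓞 ℚ) (𝓞 L)), RingOfIntegers.norm_algebraMap] at h1
    have h2 : IsUnit ((p : 𝓞 ℚ)) := by
      refine (isUnit_pow_iff ?_).1 h1
      exact Module.finrank_pos.ne'
    have h3 := h2.map Rat.ringOfIntegersEquiv
    rw [map_natCast] at h3
    exact (Nat.prime_iff_prime_int.1 hp).not_isUnit h3
  obtain ⟨P, hP, h⟩ := exists_max_ideal_of_mem_nonunits hnu
  exact ⟨P, hP.isPrime, h⟩

/-- If the constant term of a split integral polynomial has `p`-adic order one at a prime `p`
unramified in `K`, then inertia acts transitively on the roots reducing to zero. -/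
theorem exists_mem_inertia_smul_eq [IsGalois K L] {p : ℕ} (hp : p.Prime)
    (hdisc : ¬ (p : ℤ) ∣ discr K) (P : Ideal (𝓞 L)) [P.IsPrime] (hpP : (p : 𝓞 L) ∈ P)
    {h : ℤ[X]} {S : Finset (𝓞 L)}
    (hS : h.map (Int.castRingHom (𝓞 L)) = ∏ r ∈ S, (X - C r))
    (hdvd : (p : ℤ) ∣ h.coeff 0) (hndvd : ¬ (p : ℤ) ^ 2 ∣ h.coeff 0)
    {x y : 𝓞 L} (hx : x ∈ S) (hxP : x ∈ P) (hy : y ∈ S) (hyP : y ∈ P) :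
    ∃ σ ∈ P.inertia Gal(L/K), σ • x = y := by
  classical
  by_contra! hxy
  have hP : P ≠ ⊥ := by
    rintro rfl
    exact hp.ne_zero (by simpa using hpP)
  have hSσ : ∀ (σ : Gal(L/K)), ∀ z ∈ S, σ • z ∈ S := fun σ z hz => smul_mem_of_map_eq_prod hS σ hz
  have hPσ : ∀ σ ∈ P.inertia Gal(L/K), ∀ z, σ • z ∈ P ↔ z ∈ P := fun σ hσ z => by
    have := hσ z
    constructor
    · intro h
      simpa using P.sub_mem h this
    · intro h
      simpa using P.add_mem this h
  -- `O` is the inertia orbit of `x` and `O'` the set of other roots in `P`, which contains `y`.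
  -- Both products are fixed by inertia and lie in `P`, hence in `P ^ e`. The constant term then
  -- lies in `P ^ (2 * e)`, whereas order one at `p` allows only `P ^ e`.
  let O : Finset (𝓞 L) := S.filter fun z => ∃ σ ∈ P.inertia Gal(L/K), σ • x = z
  let O' : Finset (𝓞 L) :=
    S.filter fun z => z ∈ P ∧ ¬ ∃ σ ∈ P.inertia Gal(L/K), σ • x = z
  have hstab : ∀ (U : Finset (𝓞 L)) (_ : ∀ σ ∈ P.inertia Gal(L/K), ∀ z ∈ U, σ • z ∈ U),
      ∀ σ ∈ P.inertia Gal(L/K), σ • ∏ z ∈ U, z = ∏ z ∈ U, z := by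
    intro U hU σ hσ
    rw [Finset.smul_prod']
    refine Finset.prod_bij (fun z _ => σ • z) (fun z hz => hU σ hσ z hz)
      (fun a _ b _ hab => smul_left_cancel σ hab) (fun z hz => ?_) fun _ _ => rfl
    exact ⟨σ⁻¹ • z, hU _ (inv_mem hσ) z hz, by simp⟩
  set e := P.ramificationIdx (𝓞 K) with he
  have he0 : 0 < e := Ideal.ramificationIdx_pos P (𝓞 K)
  have hO : ∏ z ∈ O, z ∈ P ^ e := by
    refine mem_pow_ramificationIdx_of_inertia_fixed P hP ?_ (hstab O ?_)
    · exact Ideal.mem_of_dvd _ (Finset.dvd_prod_of_mem _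
        (Finset.mem_filter.2 ⟨hx, 1, one_mem _, one_smul _ _⟩)) hxP
    · rintro σ hσ z hz
      obtain ⟨hzS, τ, hτ, rfl⟩ := Finset.mem_filter.1 hz
      exact Finset.mem_filter.2 ⟨hSσ σ _ hzS, σ * τ, mul_mem hσ hτ, mul_smul _ _ _⟩
  have hO' : ∏ z ∈ O', z ∈ P ^ e := by
    refine mem_pow_ramificationIdx_of_inertia_fixed P hP ?_ (hstab O' ?_)
    · refine Ideal.mem_of_dvd _ (Finset.dvd_prod_of_mem _
        (Finset.mem_filter.2 ⟨hy, hyP, ?_⟩)) hyP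
      rintro ⟨σ, hσ, h⟩
      exact hxy σ hσ h
    · rintro σ hσ z hz
      obtain ⟨hzS, hzP, hz⟩ := Finset.mem_filter.1 hz
      refine Finset.mem_filter.2 ⟨hSσ σ _ hzS, (hPσ σ hσ z).2 hzP, ?_⟩
      rintro ⟨τ, hτ, h⟩
      exact hz ⟨σ⁻¹ * τ, mul_mem (inv_mem hσ) hτ, by rw [mul_smul, h, inv_smul_smul]⟩
  have hprod : ∏ z ∈ S, z ∈ P ^ (e + 1) := by
    have hdisj : Disjoint O O' := Finset.disjoint_left.2 fun z hz hz' =>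
      (Finset.mem_filter.1 hz').2.2 (Finset.mem_filter.1 hz).2
    have hsub : O ∪ O' ⊆ S := Finset.union_subset (Finset.filter_subset _ _)
      (Finset.filter_subset _ _)
    refine Ideal.mem_of_dvd _ (Finset.prod_dvd_prod_of_subset _ _ _ hsub) ?_
    rw [Finset.prod_union hdisj]
    have := Ideal.mul_mem_mul hO hO'
    rw [← pow_add] at this
    exact Ideal.pow_le_pow_right (by omega) this
  obtain ⟨u, hu⟩ := hdvd
  have hcoeff : ((p : 𝓞 L) * (u : 𝓞 L)) ∈ P ^ (e + 1) := by
    have h0 : ((h.coeff 0 : ℤ) : 𝓞 L) = ∏ z ∈ S, (-z) := by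
      have := congrArg (fun q => q.coeff 0) hS
      simpa [coeff_zero_prod] using this
    have h1 : ∏ z ∈ S, (-z) ∈ P ^ (e + 1) := by
      rw [Finset.prod_neg]
      exact Ideal.mul_mem_left _ _ hprod
    rw [← h0, hu] at h1
    simpa using h1
  rw [mul_comm] at hcoeff
  rcases Ideal.IsPrime.mul_mem_pow P hcoeff with h1 | h1
  · apply hndvd
    rw [hu, pow_two]
    refine mul_dvd_mul_left _ ?_
    have hlies : P.LiesOver (Ideal.span {(p : ℤ)}) :=
      (Ideal.liesOver_span_iff (Ideal.IsPrime.ne_top inferInstance)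
        (Nat.prime_iff_prime_int.1 hp)).2 (by simpa using hpP)
    rw [← Ideal.mem_span_singleton, Ideal.mem_of_liesOver P (Ideal.span {(p : ℤ)})]
    simpa using h1
  · exact natCast_notMem_pow_ramificationIdx_succ hp hdisc P hpP h1

/-- A split integral polynomial whose reduction at a prime unramified in `K` has a single double
root, at which the constant term has order one, has a Galois automorphism acting on its roots as
a transposition. -/
theorem exists_smul_swap [IsGalois K L] {p : ℕ} (hp : p.Prime)
    (hdisc : ¬ (p : ℤ) ∣ discr K) {h : ℤ[X]} {S : Finset (𝓞 L)}
    (hS : h.map (Int.castRingHom (𝓞 L)) = ∏ r ∈ S, (X - C r))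
    {Ψ : (ZMod p)[X]} (hh : h.map (Int.castRingHom (ZMod p)) = X ^ 2 * Ψ) (hsep : Ψ.Separable)
    (h0 : Ψ.eval 0 ≠ 0) (hndvd : ¬ (p : ℤ) ^ 2 ∣ h.coeff 0) :
    ∃ (τ : Gal(L/K)) (a b : 𝓞 L), a ≠ b ∧ a ∈ S ∧ b ∈ S ∧
      τ • a = b ∧ τ • b = a ∧ ∀ x ∈ S, x ≠ a → x ≠ b → τ • x = x := by
  have : Fact p.Prime := ⟨hp⟩
  obtain ⟨P, hPprime, hpP⟩ := exists_isPrime_natCast_mem (L := L) hp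
  obtain ⟨a, ha, b, hb, hab, haP, hbP, hsmall, hdist⟩ :=
    exists_pair_of_map_eq_X_sq_mul P hpP hS hh hsep h0
  have hdvd : (p : ℤ) ∣ h.coeff 0 := by
    rw [← ZMod.intCast_zmod_eq_zero_iff_dvd]
    have := congrArg (fun F => F.coeff 0) hh
    simpa using this
  obtain ⟨τ, hτ, hτa⟩ := exists_mem_inertia_smul_eq (K := K) hp hdisc P hpP hS hdvd hndvd
    ha haP hb hbP
  have hSσ : ∀ z ∈ S, τ • z ∈ S := fun z hz => smul_mem_of_map_eq_prod hS τ hz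
  refine ⟨τ, a, b, hab, ha, hb, hτa, ?_, fun x hx hxa hxb => ?_⟩
  · have h1 : τ • b ∈ P := by simpa using P.add_mem (hτ b) hbP
    refine (hsmall _ (hSσ b hb) h1).resolve_right fun h2 => hab ?_
    exact smul_left_cancel τ (hτa.trans h2.symm)
  -- Inertia preserves reductions, and the reductions of the other roots are distinct.
  · have hxP : x ∉ P := fun h => (hsmall x hx h).elim hxa hxb
    refine (hdist x hx _ (hSσ x hx) hxP ?_).symm
    simpa using P.neg_mem (hτ x)

end Inertia

/-! ### The polynomials `g ∘ f^m`. -/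

section CompIterate

variable {R : Type*} [CommRing R]

/-- The polynomial `g ∘ f^m`. -/
noncomputable def compIterate (f g : R[X]) (m : ℕ) : R[X] := g.comp (f.comp^[m] X)

theorem eval_iterate_comp (f : R[X]) (m : ℕ) (x : R) :
    (f.comp^[m] X).eval x = (fun y => f.eval y)^[m] x := by
  induction m with
  | zero => simp
  | succ m ih => rw [Function.iterate_succ_apply', Function.iterate_succ_apply', eval_comp, ih]

theorem eval_compIterate (f g : R[X]) (m : ℕ) (x : R) :
    (compIterate f g m).eval x = g.eval ((fun y => f.eval y)^[m] x) := by
  rw [compIterate, eval_comp, eval_iterate_comp]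

theorem map_iterate_comp {S : Type*} [CommRing S] (φ : R →+* S) (f : R[X]) (m : ℕ) :
    (f.comp^[m] X).map φ = (f.map φ).comp^[m] X := by
  induction m with
  | zero => simp
  | succ m ih => rw [Function.iterate_succ_apply', Function.iterate_succ_apply', map_comp, ih]

theorem map_compIterate {S : Type*} [CommRing S] (φ : R →+* S) (f g : R[X]) (m : ℕ) :
    (compIterate f g m).map φ = compIterate (f.map φ) (g.map φ) m := by
  rw [compIterate, map_comp, map_iterate_comp, compIterate]

theorem natDegree_monic_iterate_comp [IsDomain R] {f : R[X]} (hf : f.Monic)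
    (hd : f.natDegree ≠ 0) (m : ℕ) :
    (f.comp^[m] X).natDegree = f.natDegree ^ m ∧ (f.comp^[m] X).Monic := by
  induction m with
  | zero => simp [monic_X]
  | succ m ih =>
    rw [Function.iterate_succ_apply', natDegree_comp, ih.1, pow_succ']
    refine ⟨rfl, hf.comp ih.2 ?_⟩
    rw [ih.1]
    exact pow_ne_zero _ hd

theorem natDegree_compIterate [IsDomain R] {f : R[X]} (g : R[X]) (hf : f.Monic)
    (hd : f.natDegree ≠ 0) (m : ℕ) :
    (compIterate f g m).natDegree = g.natDegree * f.natDegree ^ m := by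
  rw [compIterate, natDegree_comp, (natDegree_monic_iterate_comp hf hd m).1]

theorem monic_compIterate [IsDomain R] {f g : R[X]} (hf : f.Monic) (hg : g.Monic)
    (hd : f.natDegree ≠ 0) (m : ℕ) : (compIterate f g m).Monic := by
  obtain ⟨h1, h2⟩ := natDegree_monic_iterate_comp hf hd m
  refine hg.comp h2 ?_
  rw [h1]
  exact pow_ne_zero _ hd

theorem compIterate_X_pow (d e m : ℕ) :
    compIterate (X ^ d : R[X]) (X ^ e) m = X ^ (e * d ^ m) := by
  have h : ∀ m, (X ^ d : R[X]).comp^[m] X = X ^ d ^ m := fun m => by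
    induction m with
    | zero => simp
    | succ m ih => rw [Function.iterate_succ_apply', ih, X_pow_comp, ← pow_mul, pow_succ]
  rw [compIterate, h, X_pow_comp, ← pow_mul, mul_comm]

/-- Modulo `k` the point `0` is fixed by `f`, so one condition on `f` controls the constant terms at
all levels. -/
theorem dvd_coeff_zero_compIterate_sub {f : R[X]} (g : R[X]) {k : R} (hk : k ∣ f.coeff 0)
    (m : ℕ) : k ∣ (compIterate f g m).coeff 0 - g.coeff 0 := by
  have h1 : ∀ F : R[X], ∀ y, k ∣ y → k ∣ F.eval y - F.coeff 0 := fun F y hy => by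
    rw [coeff_zero_eq_eval_zero]
    exact dvd_trans (by simpa using hy) (sub_dvd_eval_sub y 0 F)
  rw [coeff_zero_eq_eval_zero, eval_compIterate]
  refine h1 g _ ?_
  induction m with
  | zero => simp
  | succ m ih =>
    rw [Function.iterate_succ_apply']
    simpa using dvd_add (h1 f _ ih) hk

end CompIterate

/-! ### Counting roots level by level. -/

section Counting

variable {A : Type*} [CommRing A] [IsDomain A]

theorem eq_prod_roots_toFinset_of_card [DecidableEq A] {F : A[X]} (hF : F.Monic)
    (h : F.roots.toFinset.card = F.natDegree) : F = ∏ r ∈ F.roots.toFinset, (X - C r) := by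
  have h1 : F.roots.toFinset.card ≤ Multiset.card F.roots := Multiset.toFinset_card_le _
  have h2 : Multiset.card F.roots = F.natDegree := le_antisymm (card_roots' F) (h ▸ h1)
  have h3 : F.roots.Nodup := Multiset.toFinset_card_eq_card_iff_nodup.1 (h.trans h2.symm)
  conv_lhs => rw [← prod_multiset_X_sub_C_of_monic_of_roots_card_eq hF h2]
  rw [Finset.prod, Multiset.toFinset_val, h3.dedup]

theorem mem_roots_compIterate [DecidableEq A] {F G : A[X]} (hF : F.Monic) (hG : G.Monic)
    (hd : F.natDegree ≠ 0) {m : ℕ} {x : A} :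
    x ∈ (compIterate F G m).roots.toFinset ↔ G.eval ((fun y => F.eval y)^[m] x) = 0 := by
  rw [Multiset.mem_toFinset, mem_roots (monic_compIterate hF hG hd m).ne_zero, IsRoot.def,
    eval_compIterate]

/-- If the last level of the tower of preimages of the roots of `G` under iterates of `F` has the
maximal number of elements, then so do all lower levels and all fibres. -/
theorem card_roots_compIterate [DecidableEq A] {F G : A[X]} (hF : F.Monic) (hG : G.Monic)
    (hd : F.natDegree ≠ 0) {n : ℕ}
    (hn : (compIterate F G n).roots.toFinset.card = G.natDegree * F.natDegree ^ n) :
    (∀ m ≤ n, (compIterate F G m).roots.toFinset.card = G.natDegree * F.natDegree ^ m) ∧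
      ∀ m < n, ∀ x ∈ (compIterate F G m).roots.toFinset,
        (F - C x).roots.toFinset.card = F.natDegree := by
  have hdeg : ∀ x, (F - C x).natDegree = F.natDegree := fun x => natDegree_sub_C
  have hne : ∀ x, F - C x ≠ 0 := fun x h => hd (by rw [← hdeg x, h, natDegree_zero])
  have hle : ∀ x, (F - C x).roots.toFinset.card ≤ F.natDegree := fun x =>
    (Multiset.toFinset_card_le _).trans ((card_roots' _).trans (hdeg x).le)
  have hcard : ∀ m, (compIterate F G m).roots.toFinset.card ≤ G.natDegree * F.natDegree ^ m :=
    fun m => (Multiset.toFinset_card_le _).trans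
      ((card_roots' _).trans (natDegree_compIterate G hF hd m).le)
  have hstep : ∀ m, (compIterate F G (m + 1)).roots.toFinset.card =
      ∑ x ∈ (compIterate F G m).roots.toFinset, (F - C x).roots.toFinset.card := by
    intro m
    rw [Finset.card_eq_sum_card_fiberwise (f := fun y => F.eval y)
      (t := (compIterate F G m).roots.toFinset)]
    · refine Finset.sum_congr rfl fun x hx => congrArg Finset.card ?_
      ext y
      rw [mem_roots_compIterate hF hG hd] at hx
      rw [Finset.mem_filter, mem_roots_compIterate hF hG hd, Multiset.mem_toFinset,
        mem_roots (hne x), Function.iterate_succ_apply]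
      simp only [IsRoot.def, eval_sub, eval_C, sub_eq_zero]
      exact ⟨fun h => h.2, fun h => ⟨by rw [h]; exact hx, h⟩⟩
    · intro y hy
      rw [Finset.mem_coe, mem_roots_compIterate hF hG hd] at hy ⊢
      exact hy
  have hdown : ∀ m, (compIterate F G (m + 1)).roots.toFinset.card =
      G.natDegree * F.natDegree ^ (m + 1) →
      (compIterate F G m).roots.toFinset.card = G.natDegree * F.natDegree ^ m ∧
      ∀ x ∈ (compIterate F G m).roots.toFinset,
        (F - C x).roots.toFinset.card = F.natDegree := by
    intro m hm
    rw [hstep] at hm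
    have h1 : ∑ x ∈ (compIterate F G m).roots.toFinset, (F - C x).roots.toFinset.card ≤
        (compIterate F G m).roots.toFinset.card * F.natDegree := by
      rw [← smul_eq_mul]
      exact Finset.sum_le_card_nsmul _ _ _ fun x _ => hle x
    have h2 : (compIterate F G m).roots.toFinset.card = G.natDegree * F.natDegree ^ m := by
      refine le_antisymm (hcard m) ?_
      refine Nat.le_of_mul_le_mul_right (c := F.natDegree) ?_ (Nat.pos_of_ne_zero hd)
      rw [mul_assoc, ← pow_succ, ← hm]
      exact h1
    -- No fibre exceeds the degree, so a maximal total forces every fibre to be maximal.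
    refine ⟨h2, (Finset.sum_eq_sum_iff_of_le fun x _ => hle x).1 ?_⟩
    rw [hm, Finset.sum_const, h2, smul_eq_mul, pow_succ, mul_assoc]
  have hall : ∀ m ≤ n, (compIterate F G m).roots.toFinset.card = G.natDegree * F.natDegree ^ m := by
    intro m hm
    induction hm using Nat.decreasingInduction with
    | self => exact hn
    | of_succ k _ ih => exact (hdown k ih).1
  exact ⟨hall, fun m hm => (hdown m (hall (m + 1) hm)).2⟩

end Counting

/-! ### The local conditions on `f` and `g`. -/

section LocalConditions

variable {A : Type*} [CommRing A]

/-- Integral polynomials congruent modulo `p` take congruent values modulo an ideal over `p`. -/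
theorem eval_map_sub_mem {p : ℕ} {P : Ideal A} (hpP : (p : A) ∈ P) {h H : ℤ[X]}
    (hh : h.map (Int.castRingHom (ZMod p)) = H.map (Int.castRingHom (ZMod p))) (x : A) :
    (h.map (Int.castRingHom A)).eval x - (H.map (Int.castRingHom A)).eval x ∈ P := by
  have h1 : C (p : ℤ) ∣ h - H := by
    rw [C_dvd_iff_dvd_coeff]
    intro i
    rw [← ZMod.intCast_zmod_eq_zero_iff_dvd]
    have := congrArg (fun F => F.coeff i) hh
    simp only [coeff_map, eq_intCast] at this
    rw [coeff_sub, Int.cast_sub, this, sub_self]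
  obtain ⟨k, hk⟩ := h1
  rw [← eval_sub, ← Polynomial.map_sub, hk, Polynomial.map_mul, map_C, eval_mul, eval_C]
  exact P.mul_mem_right _ (by simpa using hpP)

theorem dvd_of_intCast_mem {p : ℕ} (hp : p.Prime) {P : Ideal A} [P.IsPrime] (hpP : (p : A) ∈ P)
    {k : ℤ} (hk : (k : A) ∈ P) : (p : ℤ) ∣ k := by
  by_contra h
  have hcop : IsCoprime (p : ℤ) k := (Nat.prime_iff_prime_int.1 hp).coprime_iff_not_dvd.2 h
  obtain ⟨a, b, hab⟩ := hcop
  refine (Ideal.IsPrime.ne_top (I := P) inferInstance) (P.eq_top_iff_one.2 ?_)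
  have := congrArg (Int.cast : ℤ → A) hab
  push_cast at this
  rw [← this]
  exact P.add_mem (P.mul_mem_left _ hpP) (P.mul_mem_left _ hk)

/-- If `∏ (X - y)` is congruent to `X ^ k * (X - c)` at `P`, all but one of the `y` lie in `P`. -/
theorem exists_unique_notMem {P : Ideal A} [P.IsPrime] {V : Finset A} {k : ℕ} {c : A}
    (hc : c ∉ P)
    (h : ∀ x, (∏ y ∈ V, (X - C y)).eval x - x ^ k * (x - c) ∈ P)
    (h' : (derivative (∏ y ∈ V, (X - C y))).eval c - c ^ k ∈ P) :
    ∃ x₀ ∈ V, x₀ ∉ P ∧ ∀ y ∈ V, y ≠ x₀ → y ∈ P := by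
  obtain ⟨x₀, hx₀, hcx₀⟩ := exists_mem_of_eval_prod_mem (S := V) (P := P) (c := c) (by
    simpa using h c)
  refine ⟨x₀, hx₀, fun hP => hc (by simpa using P.add_mem hcx₀ hP), fun y hy hne => ?_⟩
  have h0 : (∏ y ∈ V, (X - C y)).eval y = 0 := by
    rw [eval_prod]
    exact Finset.prod_eq_zero hy (by simp)
  have h1 := h y
  rw [h0, zero_sub, neg_mem_iff] at h1
  rcases Ideal.IsPrime.mem_or_mem inferInstance h1 with h2 | h2
  · exact Ideal.IsPrime.mem_of_pow_mem inferInstance _ h2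
  · exfalso
    have h3 : c - y ∈ P := by simpa using P.neg_mem h2
    -- A second root congruent to `c` would make the derivative at `c` vanish modulo `P`, but there
    -- it is `c ^ k`.
    have h4 := eval_derivative_prod_mem hx₀ hy hne.symm hcx₀ h3
    refine hc (Ideal.IsPrime.mem_of_pow_mem inferInstance k ?_)
    simpa using P.sub_mem h4 h'

/-- Local condition making all `g ∘ f^m` Eisenstein at `q`. -/
structure TransitiveAt (d : ℕ) (f g : ℤ[X]) (q : ℕ) : Prop where
  map_f : f.map (Int.castRingHom (ZMod q)) = (X ^ d : ℤ[X]).map (Int.castRingHom (ZMod q))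
  map_g : g.map (Int.castRingHom (ZMod q)) = (X ^ (d - 1) : ℤ[X]).map (Int.castRingHom (ZMod q))
  dvd_f : (q : ℤ) ^ 2 ∣ f.coeff 0
  not_dvd_g : ¬ (q : ℤ) ^ 2 ∣ g.coeff 0

/-- Local condition making inertia at `r` act transitively on all but one point of a fibre of
`f`. -/
structure DoublyTransitiveAt (d : ℕ) (f g : ℤ[X]) (r : ℕ) : Prop where
  map_f : f.map (Int.castRingHom (ZMod r)) =
    (X ^ (d - 1) * (X - C (d : ℤ)) : ℤ[X]).map (Int.castRingHom (ZMod r))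
  map_g : g.map (Int.castRingHom (ZMod r)) =
    (X ^ (d - 2) * (X - C ((d : ℤ) - 1)) : ℤ[X]).map (Int.castRingHom (ZMod r))
  not_dvd : ¬ (r : ℤ) ∣ d
  not_dvd_pred : ¬ (r : ℤ) ∣ d - 1
  dvd_f : (r : ℤ) ^ 2 ∣ f.coeff 0
  not_dvd_g : ¬ (r : ℤ) ^ 2 ∣ g.coeff 0

/-- Local condition making inertia at `p` act as a transposition on the roots of `h`. -/
def SwapAt (h : ℤ[X]) (p : ℕ) : Prop :=
  ∃ Ψ : (ZMod p)[X], h.map (Int.castRingHom (ZMod p)) = X ^ 2 * Ψ ∧ Ψ.Separable ∧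
    Ψ.eval 0 ≠ 0 ∧ ¬ (p : ℤ) ^ 2 ∣ h.coeff 0

/-- Applied with `k` the square of a prime, to keep the constant term at order at most one on every
level. -/
theorem not_sq_dvd_coeff_zero_compIterate {f g : ℤ[X]} {k : ℤ} (hf : k ∣ f.coeff 0)
    (hg : ¬ k ∣ g.coeff 0) (m : ℕ) : ¬ k ∣ (compIterate f g m).coeff 0 := fun h =>
  hg ((dvd_iff_dvd_of_dvd_sub (dvd_coeff_zero_compIterate_sub g hf m)).1 h)

theorem TransitiveAt.map_compIterate {d q : ℕ} {f g : ℤ[X]} (h : TransitiveAt d f g q) (m : ℕ) :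
    (compIterate f g m).map (Int.castRingHom (ZMod q)) =
      (X ^ ((d - 1) * d ^ m) : ℤ[X]).map (Int.castRingHom (ZMod q)) := by
  rw [_root_.map_compIterate, h.map_f, h.map_g, ← _root_.map_compIterate, compIterate_X_pow]

theorem TransitiveAt.dvd_coeff_zero {d q : ℕ} {f g : ℤ[X]} (h : TransitiveAt d f g q)
    (hd : 2 ≤ d) (m : ℕ) : (q : ℤ) ∣ (compIterate f g m).coeff 0 := by
  have := congrArg (fun F => F.coeff 0) (h.map_compIterate m)
  rw [← ZMod.intCast_zmod_eq_zero_iff_dvd]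
  have h0 : 0 ≠ (d - 1) * d ^ m := (Nat.mul_pos (by omega) (pow_pos (by omega) m)).ne
  simpa [coeff_X_pow, h0] using this

/-- Eisenstein's criterion at `q`. Irreducibility over `ℤ` serves to make the roots distinct;
transitivity over `K` is obtained from inertia instead. -/
theorem TransitiveAt.irreducible {d q : ℕ} {f g : ℤ[X]} (h : TransitiveAt d f g q) (hq : q.Prime)
    (hd : 2 ≤ d) (hf : f.Monic) (hg : g.Monic) (hfd : f.natDegree = d)
    (hgd : g.natDegree = d - 1) (m : ℕ) : Irreducible (compIterate f g m) := by
  have hqz : Prime (q : ℤ) := Nat.prime_iff_prime_int.1 hq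
  have hmonic := monic_compIterate hf hg (by omega) m
  have hdeg : (compIterate f g m).natDegree = (d - 1) * d ^ m := by
    rw [natDegree_compIterate g hf (by omega), hfd, hgd]
  have heis : (compIterate f g m).IsEisensteinAt (Ideal.span {(q : ℤ)}) := by
    refine ⟨?_, fun {i} hi => ?_, ?_⟩
    · rw [hmonic.leadingCoeff, Ideal.mem_span_singleton]
      exact fun h => hqz.not_isUnit (isUnit_of_dvd_one h)
    · have := congrArg (fun F => F.coeff i) (h.map_compIterate m)
      rw [Ideal.mem_span_singleton, ← ZMod.intCast_zmod_eq_zero_iff_dvd]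
      rw [hdeg] at hi
      simpa [coeff_X_pow, hi.ne] using this
    · rw [Ideal.span_singleton_pow, Ideal.mem_span_singleton]
      exact not_sq_dvd_coeff_zero_compIterate h.dvd_f h.not_dvd_g m
  refine heis.irreducible ((Ideal.span_singleton_prime hqz.ne_zero).2 hqz) hmonic.isPrimitive ?_
  rw [hdeg]
  exact Nat.mul_pos (by omega) (pow_pos (by omega) m)

end LocalConditions

/-! ### From local conditions to the full Galois group. -/

section GaloisTower

theorem eval_map_ringOfIntegers {L : Type*} [Field L] (h : ℤ[X]) (x : 𝓞 L) :
    (h.map (Int.castRingHom L)).eval (algebraMap (𝓞 L) L x) =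
      algebraMap (𝓞 L) L ((h.map (Int.castRingHom (𝓞 L))).eval x) := by
  have hmap : h.map (Int.castRingHom L) =
      (h.map (Int.castRingHom (𝓞 L))).map (algebraMap (𝓞 L) L) := by
    rw [map_map]
    exact congrArg (fun φ => h.map φ) (RingHom.ext_int _ _)
  rw [hmap, eval_map, eval₂_at_apply]

/-- A monic integral polynomial that is irreducible and splits in `L` has as many roots in the
ring of integers of `L` as its degree. -/
theorem card_roots_ringOfIntegers {L : Type*} [Field L] [NumberField L] [DecidableEq (𝓞 L)]
    {h : ℤ[X]} (hm : h.Monic) (hirr : Irreducible h)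
    (hsplit : (h.map (Int.castRingHom L)).Splits) :
    (h.map (Int.castRingHom (𝓞 L))).roots.toFinset.card = h.natDegree := by
  classical
  have hsep : (h.map (Int.castRingHom L)).Separable := by
    have h1 : (h.map (algebraMap ℤ ℚ)).Separable :=
      ((hm.irreducible_iff_irreducible_map_fraction_map (K := ℚ)).1 hirr).separable
    have h2 := h1.map (f := algebraMap ℚ L)
    rwa [map_map, RingHom.ext_int ((algebraMap ℚ L).comp (algebraMap ℤ ℚ)) (Int.castRingHom L)]
      at h2
  have hne : h.map (Int.castRingHom L) ≠ 0 := (hm.map _).ne_zero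
  have hne' : h.map (Int.castRingHom (𝓞 L)) ≠ 0 := (hm.map _).ne_zero
  have h1 : (h.map (Int.castRingHom L)).roots.toFinset.card = h.natDegree := by
    rw [Multiset.toFinset_card_of_nodup (nodup_roots hsep), ← hm.natDegree_map (Int.castRingHom L)]
    exact hsplit.natDegree_eq_card_roots.symm
  rw [← h1, ← Finset.card_image_of_injective _ (RingOfIntegers.coe_injective (K := L))]
  congr 1
  ext x
  simp only [Finset.mem_image, Multiset.mem_toFinset, mem_roots hne, mem_roots hne', IsRoot.def]
  constructor
  · rintro ⟨y, hy, rfl⟩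
    rw [eval_map_ringOfIntegers, hy, map_zero]
  · intro hx
    obtain ⟨y, rfl⟩ : ∃ y : 𝓞 L, algebraMap (𝓞 L) L y = x :=
      ⟨⟨x, h, hm, by rwa [eval_map] at hx⟩, rfl⟩
    refine ⟨y, RingOfIntegers.coe_injective ?_, rfl⟩
    rw [map_zero, ← eval_map_ringOfIntegers]
    exact hx

/-- The Galois group generated by the roots of `g ∘ f^n` is the full iterated wreath product,
provided that `f` and `g` satisfy suitable local conditions at primes unramified in `K`. -/
theorem nonempty_gal_mulEquiv_symWreath {K L : Type*} [Field K] [Field L] [NumberField K]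
    [NumberField L] [Algebra K L] [IsGalois K L] {d n : ℕ} (hd : 2 ≤ d) {f g : ℤ[X]}
    (hf : f.Monic) (hg : g.Monic) (hfd : f.natDegree = d) (hgd : g.natDegree = d - 1)
    (hsplit : ((compIterate f g n).map (Int.castRingHom L)).Splits)
    (hgen : IntermediateField.adjoin K
      {x : L | ((compIterate f g n).map (Int.castRingHom L)).eval x = 0} = ⊤)
    (htrans : ∃ q : ℕ, q.Prime ∧ ¬ (q : ℤ) ∣ discr K ∧ TransitiveAt d f g q)
    (hdouble : 3 ≤ d → ∃ r : ℕ, r.Prime ∧ ¬ (r : ℤ) ∣ discr K ∧ DoublyTransitiveAt d f g r)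
    (hswap : ∀ m ≤ n, (m = 0 → 3 ≤ d) → ∃ p : ℕ, p.Prime ∧ ¬ (p : ℤ) ∣ discr K ∧
      SwapAt (compIterate f g m) p) :
    Nonempty (Gal(L/K) ≃* SymWreath (d - 1) (iteratedSymWreath d n)) := by
  classical
  have hd0 : 0 < d - 1 := by omega
  have hd3' : 2 ≤ d - 1 → 3 ≤ d := by omega
  have hd2' : 3 ≤ d → 0 ≠ d - 2 := by omega
  obtain ⟨q, hq, hqK, hqt⟩ := htrans
  set F := f.map (Int.castRingHom (𝓞 L)) with hFdef
  set G := g.map (Int.castRingHom (𝓞 L)) with hGdef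
  have hF : F.Monic := hf.map _
  have hG : G.Monic := hg.map _
  have hFd : F.natDegree = d := by rw [hFdef, hf.natDegree_map, hfd]
  have hGd : G.natDegree = d - 1 := by rw [hGdef, hg.natDegree_map, hgd]
  have hF0 : F.natDegree ≠ 0 := by omega
  have hcomp : ∀ m, (compIterate f g m).map (Int.castRingHom (𝓞 L)) = compIterate F G m :=
    fun m => map_compIterate _ _ _ _
  let φ : 𝓞 L → 𝓞 L := fun x => F.eval x
  let R : Set (𝓞 L) := {x | G.eval x = 0}
  let U : ℕ → Finset (𝓞 L) := fun m => (compIterate F G m).roots.toFinset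
  have hU : ∀ m x, x ∈ U m ↔ φ^[m] x ∈ R := fun m x => mem_roots_compIterate hF hG hF0
  have hsmul : ∀ (h : ℤ[X]) (σ : Gal(L/K)) (x : 𝓞 L),
      (h.map (Int.castRingHom (𝓞 L))).eval (σ • x) =
        σ • (h.map (Int.castRingHom (𝓞 L))).eval x := fun h σ x => by
    have := aeval_algHom_apply (MulSemiringAction.toAlgHom ℤ (𝓞 L) σ) x h
    simp only [aeval_def, ← eval_map, algebraMap_int_eq] at this
    exact this
  have hφ : ∀ (σ : Gal(L/K)) x, φ (σ • x) = σ • φ x := fun σ x => hsmul f σ x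
  have hR : ∀ (σ : Gal(L/K)), ∀ x ∈ R, σ • x ∈ R := fun σ x hx => by
    change G.eval (σ • x) = 0
    rw [hGdef, hsmul, ← hGdef, show G.eval x = 0 from hx, smul_zero]
  obtain ⟨hcard, hfibcard⟩ := card_roots_compIterate hF hG hF0 (n := n) (by
    rw [← hcomp, card_roots_ringOfIntegers (monic_compIterate hf hg (by omega) n)
      (hqt.irreducible hq hd hf hg hfd hgd n) hsplit, natDegree_compIterate g hf (by omega),
      hfd, hgd, hFd, hGd])
  have hprod : ∀ m ≤ n, (compIterate f g m).map (Int.castRingHom (𝓞 L)) =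
      ∏ r ∈ U m, (X - C r) := fun m hm => by
    rw [hcomp]
    exact eq_prod_roots_toFinset_of_card (monic_compIterate hF hG hF0 m)
      ((hcard m hm).trans (natDegree_compIterate G hF hF0 m).symm)
  have hfibmem : ∀ x y, y ∈ (F - C x).roots.toFinset ↔ φ y = x := fun x y => by
    have hne : F - C x ≠ 0 := fun h => hF0 (by rw [← natDegree_sub_C (a := x), h, natDegree_zero])
    rw [Multiset.mem_toFinset, mem_roots hne, IsRoot.def, eval_sub, eval_C, sub_eq_zero]
  have hfibprod : ∀ m < n, ∀ x ∈ U m, F - C x = ∏ y ∈ (F - C x).roots.toFinset, (X - C y) :=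
    fun m hm x hx => eq_prod_roots_toFinset_of_card
      (by rw [sub_eq_add_neg, ← C_neg]; exact hF.add_of_left
            (degree_C_le.trans_lt (natDegree_pos_iff_degree_pos.1 (Nat.pos_of_ne_zero hF0))))
      ((hfibcard m hm x hx).trans natDegree_sub_C.symm)
  have hε : Nonempty (Fin (d - 1) ≃ R) := by
    have h0 : (U 0).card = d - 1 := by rw [hcard 0 (Nat.zero_le _), hGd, pow_zero, mul_one]
    exact ⟨((U 0).equivFinOfCardEq h0).symm.trans (Equiv.subtypeEquivRight fun x => hU 0 x)⟩
  obtain ⟨ε⟩ := hε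
  refine nonempty_mulEquiv_symWreath hφ hR hd ε ?_ ?_ ?_ ?_ ?_ ?_
  · intro m hm x hx
    have h0 := (hfibcard m hm x ((hU m x).2 hx)).trans hFd
    exact ⟨(Finset.equivFinOfCardEq h0).symm.trans
      (Equiv.subtypeEquivRight fun y => hfibmem x y)⟩
  · intro m hm x y hx hy
    obtain ⟨P, hP, hqP⟩ := exists_isPrime_natCast_mem (L := L) hq
    -- Modulo `q` the polynomial is a power of `X`, so every root of the level reduces to zero.
    have hmem : ∀ z ∈ U m, z ∈ P := fun z hz => by
      have h1 := eval_map_sub_mem hqP (hqt.map_compIterate m) z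
      have h2 : ((compIterate f g m).map (Int.castRingHom (𝓞 L))).eval z = 0 := by
        rw [hprod m hm, eval_prod]
        exact Finset.prod_eq_zero hz (by simp)
      rw [h2, zero_sub, neg_mem_iff] at h1
      exact hP.mem_of_pow_mem _ (by simpa using h1)
    rw [← hU] at hx hy
    obtain ⟨σ, -, h⟩ := exists_mem_inertia_smul_eq hq hqK P hqP (hprod m hm)
      (hqt.dvd_coeff_zero hd m) (not_sq_dvd_coeff_zero_compIterate hqt.dvd_f hqt.not_dvd_g m)
      hx (hmem x hx) hy (hmem y hy)
    exact ⟨σ, h⟩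
  · intro he
    obtain ⟨r, hr, hrK, hrt⟩ := hdouble (hd3' he)
    obtain ⟨P, hP, hrP⟩ := exists_isPrime_natCast_mem (L := L) hr
    have hdvd : (r : ℤ) ∣ (compIterate f g 0).coeff 0 := by
      rw [← ZMod.intCast_zmod_eq_zero_iff_dvd]
      have := congrArg (fun F => F.coeff 0) hrt.map_g
      have h0 := hd2' (hd3' he)
      simpa [compIterate, mul_coeff_zero, coeff_X_pow, h0] using this
    have hG' : G = ∏ y ∈ U 0, (X - C y) := by
      rw [← hprod 0 (Nat.zero_le _), hGdef]
      simp [compIterate]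
    -- `x₀` is the only critical point outside `P`; inertia fixes it and is transitive on the
    -- others.
    obtain ⟨x₀, hx₀, hx₀P, H⟩ := exists_unique_notMem (P := P) (V := U 0) (k := d - 2)
      (c := ((d : 𝓞 L) - 1))
      (fun h => hrt.not_dvd_pred (dvd_of_intCast_mem hr hrP (by push_cast; exact h)))
      (fun x => by
        rw [← hG']
        simpa using eval_map_sub_mem hrP hrt.map_g x)
      (by
        rw [← hG', hGdef, derivative_map]
        have := eval_map_sub_mem hrP (h := derivative g)
          (H := derivative (X ^ (d - 2) * (X - C ((d : ℤ) - 1)))) (by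
            rw [← derivative_map, hrt.map_g, derivative_map]) ((d : 𝓞 L) - 1)
        simpa [derivative_mul] using this)
    refine ⟨x₀, (hU 0 x₀).1 hx₀, fun y hy z hz hyx hzx => ?_⟩
    have hy := (hU 0 y).2 hy
    have hz := (hU 0 z).2 hz
    obtain ⟨σ, hσ, h⟩ := exists_mem_inertia_smul_eq hr hrK P hrP (hprod 0 (Nat.zero_le _))
      hdvd (not_sq_dvd_coeff_zero_compIterate hrt.dvd_f hrt.not_dvd_g 0)
      hy (H y hy hyx) hz (H z hz hzx)
    refine ⟨σ, ?_, h⟩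
    by_contra hne
    have h1 := H _ ((hU 0 _).2 (hR σ x₀ ((hU 0 x₀).1 hx₀))) hne
    exact hx₀P (by simpa using P.sub_mem h1 (hσ x₀))
  · intro m hm
    rcases Nat.lt_or_ge d 3 with hd3 | hd3
    -- In a fibre with two points, `x₀` has a single sibling and the identity suffices.
    · have hd2 : d = 2 := by omega
      have hpos : 0 < (U (m + 1)).card := by
        rw [hcard (m + 1) hm, hGd, hFd]
        exact Nat.mul_pos hd0 (pow_pos (by omega) _)
      obtain ⟨x₀, hx₀⟩ := Finset.card_pos.1 hpos
      rw [hU] at hx₀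
      refine ⟨x₀, hx₀, fun y z hy hz hyx hzx => ⟨1, one_smul _ _, ?_⟩⟩
      rw [one_smul]
      by_contra hyz
      have h3 : ({x₀, y, z} : Finset (𝓞 L)).card ≤ (F - C (φ x₀)).roots.toFinset.card := by
        refine Finset.card_le_card fun t ht => ?_
        rw [hfibmem]
        simp only [Finset.mem_insert, Finset.mem_singleton] at ht
        rcases ht with rfl | rfl | rfl
        · rfl
        · exact hy
        · exact hz
      rw [hfibcard m hm (φ x₀) ((hU m _).2 hx₀), hFd, Finset.card_eq_three.2
        ⟨x₀, y, z, hyx.symm, hzx.symm, hyz, rfl⟩] at h3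
      omega
    · obtain ⟨r, hr, hrK, hrt⟩ := hdouble hd3
      obtain ⟨P, hP, hrP⟩ := exists_isPrime_natCast_mem (L := L) hr
      have hdvd : ∀ m, (r : ℤ) ∣ (compIterate f g m).coeff 0 := fun m => by
        have h1 : (r : ℤ) ∣ g.coeff 0 := by
          rw [← ZMod.intCast_zmod_eq_zero_iff_dvd]
          have := congrArg (fun F => F.coeff 0) hrt.map_g
          have h0 := hd2' hd3
          simpa [mul_coeff_zero, coeff_X_pow, h0] using this
        have h2 := dvd_coeff_zero_compIterate_sub g
          ((dvd_pow_self (r : ℤ) two_ne_zero).trans hrt.dvd_f) m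
        simpa using dvd_add h2 h1
      -- Over a root `β` in `P`, the fibre polynomial `F - β` reduces to `X ^ (d - 1) * (X - d)`.
      obtain ⟨β, hβ, hβP⟩ := exists_mem_of_eval_prod_mem (S := U m) (P := P) (c := 0) (by
        rw [← hprod m (by omega), ← coeff_zero_eq_eval_zero, coeff_map]
        obtain ⟨k, hk⟩ := hdvd m
        rw [hk]
        simpa using P.mul_mem_right _ hrP)
      have hβP : β ∈ P := by simpa using hβP
      have hV := hfibprod m hm β hβ
      obtain ⟨x₀, hx₀, hx₀P, H⟩ := exists_unique_notMem (P := P)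
        (V := (F - C β).roots.toFinset) (k := d - 1) (c := (d : 𝓞 L))
        (fun h => hrt.not_dvd (dvd_of_intCast_mem hr hrP (by push_cast; exact h)))
        (fun x => by
          rw [← hV]
          have := P.sub_mem (eval_map_sub_mem hrP hrt.map_f x) hβP
          rw [eval_sub, eval_C, sub_right_comm]
          simpa using this)
        (by
          rw [← hV, derivative_sub, derivative_C, sub_zero, hFdef, derivative_map]
          have := eval_map_sub_mem hrP (h := derivative f)
            (H := derivative (X ^ (d - 1) * (X - C (d : ℤ)))) (by
              rw [← derivative_map, hrt.map_f, derivative_map]) (d : 𝓞 L)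
          simpa [derivative_mul] using this)
      have hx₀β := (hfibmem β x₀).1 hx₀
      have hlev : ∀ y, φ y = β → y ∈ U (m + 1) := fun y hy => by
        rw [hU, Function.iterate_succ_apply, hy, ← hU]
        exact hβ
      refine ⟨x₀, (hU _ _).1 (hlev x₀ hx₀β), fun y z hy hz hyx hzx => ?_⟩
      rw [hx₀β] at hy hz
      obtain ⟨σ, hσ, h⟩ := exists_mem_inertia_smul_eq hr hrK P hrP (hprod (m + 1) hm)
        (hdvd _) (not_sq_dvd_coeff_zero_compIterate hrt.dvd_f hrt.not_dvd_g _)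
        (hlev y hy) (H y ((hfibmem β y).2 hy) hyx) (hlev z hz) (H z ((hfibmem β z).2 hz) hzx)
      refine ⟨σ, ?_, h⟩
      by_contra hne
      -- Inertia is transitive on all roots of the level in `P`, across fibres; an element sending
      -- `y` to `z` fixes their common image `β`, hence the only point `x₀` of the fibre outside
      -- `P`.
      have hσβ : σ • β = β := by
        have := hφ σ y
        rwa [h, hz, hy, eq_comm] at this
      have h1 := H (σ • x₀) ((hfibmem β _).2 (by rw [hφ, hx₀β, hσβ])) hne
      exact hx₀P (by simpa using P.sub_mem h1 (hσ x₀))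
  · intro m hm h0
    obtain ⟨p, hp, hpK, Ψ, h1, h2, h3, h4⟩ := hswap m hm fun h => hd3' (h0 h)
    obtain ⟨τ, a, b, hab, ha, hb, hτa, hτb, hτ⟩ :=
      exists_smul_swap (K := K) hp hpK (hprod m hm) h1 h2 h3 h4
    exact ⟨τ, a, b, hab, (hU m a).1 ha, (hU m b).1 hb, hτa, hτb,
      fun x hx => hτ x ((hU m x).2 hx)⟩
  · intro σ hσ
    have hfix : ∀ x ∈ {x : L | ((compIterate f g n).map (Int.castRingHom L)).eval x = 0},
        σ x = x := by
      intro x hx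
      have hx : ((compIterate f g n).map (Int.castRingHom L)).eval x = 0 := hx
      obtain ⟨y, rfl⟩ : ∃ y : 𝓞 L, algebraMap (𝓞 L) L y = x :=
        ⟨⟨x, compIterate f g n, monic_compIterate hf hg (by omega) n, by rwa [eval_map] at hx⟩, rfl⟩
      have h1 : φ^[n] y ∈ R := by
        rw [← hU, Multiset.mem_toFinset, mem_roots (monic_compIterate hF hG hF0 n).ne_zero,
          IsRoot.def, ← hcomp]
        apply RingOfIntegers.coe_injective
        rw [← eval_map_ringOfIntegers, map_zero]
        exact hx
      exact congrArg (algebraMap (𝓞 L) L) (hσ _ h1)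
    refine AlgEquiv.ext fun x => ?_
    have hx : x ∈ IntermediateField.adjoin K
        {x : L | ((compIterate f g n).map (Int.castRingHom L)).eval x = 0} := by
      rw [hgen]
      trivial
    induction hx using IntermediateField.adjoin_induction with
    | mem y hy => exact hfix y hy
    | algebraMap y => exact σ.commutes y
    | add y z _ _ hy hz => rw [map_add, hy, hz, map_add]
    | inv y _ hy => rw [map_inv₀, hy, map_inv₀]
    | mul y z _ _ hy hz => rw [map_mul, hy, hz, map_mul]

end GaloisTower

/-! ### Parameters for which the critical point `0` is periodic. -/

section CriticalOrbit

/-- The polynomial in the parameter `t` giving the value at `0` of the `m`-th iterate of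
`F + t`. -/
noncomputable def critOrbit (F : ℤ[X]) : ℕ → ℤ[X]
  | 0 => 0
  | m + 1 => F.comp (critOrbit F m) + X

theorem eval_map_critOrbit {R : Type*} [CommRing R] (F : ℤ[X]) (m : ℕ) (τ : R) :
    ((critOrbit F m).map (Int.castRingHom R)).eval τ =
      (fun x => (F.map (Int.castRingHom R) + C τ).eval x)^[m] 0 := by
  induction m with
  | zero => simp [critOrbit]
  | succ m ih =>
    rw [Function.iterate_succ_apply', ← ih, critOrbit]
    simp [map_comp, eval_comp]

theorem monic_critOrbit {F : ℤ[X]} (hF : F.Monic) (hd : 2 ≤ F.natDegree) (h0 : F.coeff 0 = 0)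
    (m : ℕ) :
    (critOrbit F (m + 1)).Monic ∧ (critOrbit F (m + 1)).natDegree = F.natDegree ^ m := by
  induction m with
  | zero =>
    have : critOrbit F 1 = X := by
      rw [critOrbit, critOrbit, comp_zero, ← coeff_zero_eq_eval_zero, h0, map_zero, zero_add]
    simp [this, monic_X]
  | succ m ih =>
    have hdeg : (F.comp (critOrbit F (m + 1))).natDegree = F.natDegree ^ (m + 1) := by
      rw [natDegree_comp, ih.2, pow_succ']
    have hmon : (F.comp (critOrbit F (m + 1))).Monic := by
      refine hF.comp ih.1 ?_
      rw [ih.2]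
      exact pow_ne_zero _ (by omega)
    have hlt : (X : ℤ[X]).natDegree < (F.comp (critOrbit F (m + 1))).natDegree := by
      rw [hdeg, natDegree_X]
      exact Nat.one_lt_pow (by omega) (by omega)
    rw [critOrbit]
    refine ⟨hmon.add_of_left (degree_lt_degree hlt), ?_⟩
    rw [natDegree_add_eq_left_of_natDegree_lt hlt, hdeg]

/-- The chain rule puts a factor `F'`, hence `d`, on the composite term; the added parameter
contributes `1`. -/
theorem dvd_derivative_critOrbit_sub_one {F g : ℤ[X]} {d : ℤ} (hF : derivative F = C d * g)
    (m : ℕ) : C d ∣ derivative (critOrbit F (m + 1)) - 1 := by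
  rw [critOrbit, derivative_add, derivative_X, add_sub_cancel_right, derivative_comp, hF,
    mul_comp, C_comp]
  exact Dvd.dvd.mul_left (dvd_mul_right _ _) _

/-- A nonconstant monic integral polynomial cannot divide a polynomial congruent to `1` modulo
`d ≥ 2`. -/
theorem not_monic_dvd_of_dvd_sub_one {d : ℕ} (hd : 2 ≤ d) {h Q : ℤ[X]} (hm : h.Monic)
    (hdeg : h.natDegree ≠ 0) (hQ : C (d : ℤ) ∣ Q - 1) : ¬ h ∣ Q := by
  rintro ⟨w, hw⟩
  obtain ⟨ℓ, hℓ, hℓd⟩ := Nat.exists_prime_and_dvd (show d ≠ 1 by omega)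
  have : Fact ℓ.Prime := ⟨hℓ⟩
  obtain ⟨v, hv⟩ := hQ
  have h1 : Q.map (Int.castRingHom (ZMod ℓ)) = 1 := by
    have : Q = C (d : ℤ) * v + 1 := by rw [← hv]; ring
    have h0 : ((d : ℕ) : ZMod ℓ) = 0 := (ZMod.natCast_eq_zero_iff d ℓ).2 hℓd
    rw [this, Polynomial.map_add, Polynomial.map_mul, map_C, eq_intCast, Int.cast_natCast, h0,
      map_zero, zero_mul, zero_add, Polynomial.map_one]
  rw [hw, Polynomial.map_mul] at h1
  have h2 := (hm.map (Int.castRingHom (ZMod ℓ))).eq_one_of_isUnit (IsUnit.of_mul_eq_one _ h1)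
  apply hdeg
  rw [← hm.natDegree_map (Int.castRingHom (ZMod ℓ)), h2, natDegree_one]

/-- The polynomial of the critical orbit has simple roots. -/
theorem separable_map_critOrbit {F g : ℤ[X]} {d : ℕ} (hd : 2 ≤ d) (hFm : F.Monic)
    (hFd : F.natDegree = d) (hF0 : F.coeff 0 = 0) (hF : derivative F = C (d : ℤ) * g) (m : ℕ) :
    ((critOrbit F (m + 1)).map (Int.castRingHom ℂ)).Separable := by
  have hmon := (monic_critOrbit hFm (by omega) hF0 m).1
  rw [Polynomial.Separable, isCoprime_iff_aeval_ne_zero_of_isAlgClosed ℂ ℂ]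
  intro t
  by_contra! hcon
  obtain ⟨h1, h2⟩ := hcon
  have e1 : aeval t (critOrbit F (m + 1)) = 0 := by
    rwa [← algebraMap_int_eq, aeval_map_algebraMap] at h1
  have e2 : aeval t (derivative (critOrbit F (m + 1))) = 0 := by
    rwa [derivative_map, ← algebraMap_int_eq, aeval_map_algebraMap] at h2
  -- The minimal polynomial over `ℤ` of a multiple root would divide the derivative, which is `1`
  -- modulo `d`.
  have hintegral : IsIntegral ℤ t := ⟨_, hmon, e1⟩
  refine not_monic_dvd_of_dvd_sub_one hd (minpoly.monic hintegral) (minpoly.natDegree_pos hintegral).ne'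
    (dvd_derivative_critOrbit_sub_one hF m) (minpoly.isIntegrallyClosed_dvd hintegral e2)

theorem sum_range_pow_lt_pow {d : ℕ} (hd : 2 ≤ d) (m : ℕ) : ∑ l ∈ Finset.range m, d ^ l < d ^ m := by
  induction m with
  | zero => simp
  | succ m ih =>
    rw [Finset.sum_range_succ, pow_succ]
    nlinarith [pow_pos (show 0 < d by omega) m]

/-- There is a parameter for which the critical point `0` is periodic of exact period `m + 1`. -/
theorem exists_exact_period {F g : ℤ[X]} {d : ℕ} (hd : 2 ≤ d) (hFm : F.Monic)
    (hFd : F.natDegree = d) (hF0 : F.coeff 0 = 0) (hF : derivative F = C (d : ℤ) * g) (m : ℕ) :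
    ∃ t : ℂ, aeval t (critOrbit F (m + 1)) = 0 ∧
      ∀ l < m, aeval t (critOrbit F (l + 1)) ≠ 0 := by
  classical
  have hmon := monic_critOrbit hFm (by omega) hF0
  by_contra! hcon
  -- `D` vanishes at all parameters with a shorter return time, and its degree `∑ l < m, d ^ l` is
  -- below `d ^ m`, the number of distinct roots of `critOrbit F (m + 1)`.
  let D : ℤ[X] := ∏ l ∈ Finset.range m, critOrbit F (l + 1)
  have hD : D.Monic := monic_prod_of_monic _ _ fun l _ => (hmon l).1
  have hDdeg : D.natDegree < d ^ m := by
    rw [natDegree_prod_of_monic _ _ fun l _ => (hmon l).1,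
      Finset.sum_congr rfl fun l _ => (hmon l).2, hFd]
    exact sum_range_pow_lt_pow hd m
  have hsub : ((critOrbit F (m + 1)).map (Int.castRingHom ℂ)).roots.toFinset ⊆
      (D.map (Int.castRingHom ℂ)).roots.toFinset := by
    intro t ht
    rw [Multiset.mem_toFinset, mem_roots ((hmon m).1.map _).ne_zero, IsRoot.def, eval_map] at ht
    obtain ⟨l, hl, h⟩ := hcon t ht
    rw [Multiset.mem_toFinset, mem_roots (hD.map _).ne_zero, IsRoot.def, eval_map]
    change aeval t D = 0
    rw [map_prod]
    exact Finset.prod_eq_zero (Finset.mem_range.2 hl) h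
  have h1 := (Finset.card_le_card hsub).trans ((Multiset.toFinset_card_le _).trans (card_roots' _))
  rw [Multiset.toFinset_card_of_nodup
    (nodup_roots (separable_map_critOrbit hd hFm hFd hF0 hF m)),
    ← (IsAlgClosed.splits _).natDegree_eq_card_roots, (hmon m).1.natDegree_map,
    hD.natDegree_map, (hmon m).2, hFd] at h1
  omega

end CriticalOrbit

/-! ### A periodic critical point gives exactly one double root. -/

section Dynamics

variable {k : Type*} [Field k]

theorem derivative_iterate_comp {R : Type*} [CommRing R] (f : R[X]) (m : ℕ) :
    derivative (f.comp^[m] X) = ∏ l ∈ Finset.range m, (derivative f).comp (f.comp^[l] X) := by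
  induction m with
  | zero => simp
  | succ m ih =>
    rw [Function.iterate_succ_apply', derivative_comp, ih, Finset.prod_range_succ]

/-- If every critical point of `f` outside `0` has a forward orbit avoiding all critical points,
and `0` is periodic of exact period `m + 1`, then `0` is the only multiple root of `g ∘ f^(m+1)`,
where `g` is the derivative of `f` up to a constant, and this root is double. -/
theorem compIterate_eq_X_sq_mul [CharZero k] [IsAlgClosed k] {f g g₁ : k[X]} {d : k} (hd : d ≠ 0)
    (hf : derivative f = C d * g) (hg : g = X * g₁) (hsep : g.Separable) {m : ℕ}
    (hper : (fun x => f.eval x)^[m + 1] 0 = 0)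
    (hexact : ∀ l < m, (fun x => f.eval x)^[l + 1] 0 ≠ 0)
    (hesc : ∀ α, α ≠ 0 → g.eval α = 0 → ∀ l, g.eval ((fun x => f.eval x)^[l + 1] α) ≠ 0)
    {Ψ : k[X]} (hΨ : compIterate f g (m + 1) = X ^ 2 * Ψ) : Ψ.Separable ∧ Ψ.eval 0 ≠ 0 := by
  set φ : k → k := fun x => f.eval x with hφ
  have hg0 : g.eval 0 = 0 := by simp [hg]
  have hsimple : ∀ x, g.eval x = 0 → (derivative g).eval x ≠ 0 := fun x hx hx' => by
    obtain ⟨a, b, hab⟩ := hsep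
    have := congrArg (fun q => q.eval x) hab
    simp [hx, hx'] at this
  have hg1 : g₁.eval 0 ≠ 0 := fun h => hsimple 0 hg0 (by simp [hg, h])
  have hder : derivative (compIterate f g (m + 1)) =
      X * (C d * g₁ * (derivative g).comp (f.comp^[m + 1] X) *
        ∏ l ∈ Finset.range m, (derivative f).comp (f.comp^[l + 1] X)) := by
    rw [compIterate, derivative_comp, derivative_iterate_comp, Finset.prod_range_succ']
    simp only [Function.iterate_zero, id_eq, comp_X, hf]
    rw [show C d * g = C d * (X * g₁) by rw [hg]]
    ring
  -- The orbit of `0` returns to the critical point `0`, so it meets no other critical point, whose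
  -- later orbit would avoid all of them.
  have hcrit : ∀ l < m, g.eval (φ^[l + 1] 0) ≠ 0 := fun l hl h => by
    refine hesc _ (hexact l hl) h (m - l - 1) ?_
    rw [← Function.iterate_add_apply, show m - l - 1 + 1 + (l + 1) = m + 1 by omega, hper, hg0]
  have hΨ0 : Ψ.eval 0 ≠ 0 := by
    rw [hΨ] at hder
    -- One factor `X` cancels from the derivative of `X ^ 2 * Ψ`; at `0` this expresses `2 * Ψ 0` as
    -- a product of nonzero terms.
    have h1 : 2 * Ψ + X * derivative Ψ = C d * g₁ * (derivative g).comp (f.comp^[m + 1] X) *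
        ∏ l ∈ Finset.range m, (derivative f).comp (f.comp^[l + 1] X) := by
      refine mul_left_cancel₀ (X_ne_zero (R := k)) ?_
      rw [← hder]
      simp only [derivative_mul, derivative_X_pow, Nat.cast_ofNat, map_ofNat]
      ring
    have h2 := congrArg (fun q => q.eval 0) h1
    simp only [eval_add, eval_mul, eval_X, zero_mul, add_zero, eval_C, eval_comp, eval_prod,
      eval_iterate_comp, hf] at h2
    intro h0
    rw [h0, mul_zero, eq_comm] at h2
    simp only [mul_eq_zero, hd, hg1, false_or, Finset.prod_eq_zero_iff] at h2
    rcases h2 with h2 | ⟨l, hl, h2⟩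
    · change (derivative g).eval (φ^[m + 1] 0) = 0 at h2
      rw [hper] at h2
      exact hsimple 0 hg0 h2
    · exact hcrit l (Finset.mem_range.1 hl) h2
  refine ⟨?_, hΨ0⟩
  rw [Polynomial.Separable, isCoprime_iff_aeval_ne_zero_of_isAlgClosed k k]
  intro x
  by_contra! hcon
  obtain ⟨h1, h2⟩ := hcon
  rw [coe_aeval_eq_eval] at h1 h2
  -- By the chain rule, at such a multiple root either `g` has a multiple zero at `φ^[m + 1] x`, or
  -- some `φ^[l] x` with `l ≤ m` is critical and later reaches a critical point. Both are excluded.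
  have hx0 : x ≠ 0 := fun h => hΨ0 (h ▸ h1)
  have e1 : g.eval (φ^[m + 1] x) = 0 := by
    have := eval_compIterate f g (m + 1) x
    rw [hΨ, eval_mul, h1, mul_zero] at this
    exact this.symm
  have e2 : (derivative (compIterate f g (m + 1))).eval x = 0 := by
    rw [hΨ, derivative_mul, eval_add, eval_mul, eval_mul, h1, h2]
    ring
  rw [compIterate, derivative_comp, derivative_iterate_comp, eval_mul, eval_comp,
    eval_iterate_comp, eval_prod, mul_eq_zero, Finset.prod_eq_zero_iff] at e2
  rcases e2 with ⟨l, hl, e2⟩ | e2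
  · rw [eval_comp, eval_iterate_comp, hf, eval_mul, eval_C, mul_eq_zero] at e2
    have e3 : g.eval (φ^[l] x) = 0 := e2.resolve_left hd
    have hl := Finset.mem_range.1 hl
    have e4 : φ^[m + 1] x = φ^[m - l + 1] (φ^[l] x) := by
      rw [← Function.iterate_add_apply]
      congr 1
      omega
    rw [e4] at e1
    by_cases h0 : φ^[l] x = 0
    · rw [h0] at e1
      rcases Nat.eq_zero_or_pos l with hl0 | hl0
      · subst hl0
        exact hx0 h0
      · exact hcrit (m - l) (by omega) e1
    · exact hesc _ h0 e3 _ e1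
  · exact hsimple _ e1 e2

end Dynamics

/-! ### Specializing an algebraic integer modulo large primes. -/

section Specialization

/-- A nonconstant integral polynomial has values divisible by arbitrarily large primes. -/
theorem exists_prime_gt_dvd_eval {h : ℤ[X]} (hdeg : h.natDegree ≠ 0) (B : ℕ) :
    ∃ p : ℕ, B < p ∧ p.Prime ∧ ∃ a : ℤ, (p : ℤ) ∣ h.eval a := by
  by_cases h0 : h.coeff 0 = 0
  · obtain ⟨p, hp, hpp⟩ := Nat.exists_infinite_primes (B + 1)
    exact ⟨p, hp, hpp, 0, by rw [← coeff_zero_eq_eval_zero, h0]; exact dvd_zero _⟩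
  set c := h.coeff 0 with hc
  -- With this `N`, `h (N y) = c * u` where `u` is `1` modulo `B!`, so every prime factor of `u`
  -- exceeds `B`; `y` is chosen so that `u` is not `1` or `-1`.
  set N : ℤ := c * (B.factorial : ℤ) with hN
  have hB : (B.factorial : ℤ) ≠ 0 := by exact_mod_cast B.factorial_ne_zero
  have hN0 : N ≠ 0 := mul_ne_zero h0 hB
  have hinf : ∃ y : ℤ, h.eval (N * y) ≠ c ∧ h.eval (N * y) ≠ -c := by
    by_contra! hcon
    let q : ℤ[X] := (h.comp (C N * X) - C c) * (h.comp (C N * X) + C c)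
    have hq : q = 0 := by
      refine Polynomial.funext fun y => ?_
      by_cases hy : h.eval (N * y) = c
      · simp [q, eval_comp, hy]
      · simp [q, eval_comp, hcon y hy]
    have hnd : (h.comp (C N * X)).natDegree = h.natDegree := by
      rw [natDegree_comp, natDegree_C_mul_X _ hN0, mul_one]
    rcases mul_eq_zero.1 hq with h1 | h1
    · rw [sub_eq_zero] at h1
      rw [h1, natDegree_C] at hnd
      exact hdeg hnd.symm
    · rw [add_eq_zero_iff_eq_neg, ← C_neg] at h1
      rw [h1, natDegree_C] at hnd
      exact hdeg hnd.symm
  obtain ⟨y, hy1, hy2⟩ := hinf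
  obtain ⟨w, hw⟩ : N * y ∣ h.eval (N * y) - c := by
    rw [hc, coeff_zero_eq_eval_zero]
    simpa using sub_dvd_eval_sub (N * y) 0 h
  set u : ℤ := 1 + (B.factorial : ℤ) * (y * w) with hu
  have hval : h.eval (N * y) = c * u := by
    rw [sub_eq_iff_eq_add] at hw
    rw [hw, hu, hN]
    ring
  have hu1 : u.natAbs ≠ 1 := by
    intro h1
    rcases Int.natAbs_eq u with h2 | h2
    · exact hy1 (by rw [hval, h2, h1]; simp)
    · exact hy2 (by rw [hval, h2, h1]; simp)
  obtain ⟨p, hp, hpu⟩ := Nat.exists_prime_and_dvd hu1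
  have hpu' : (p : ℤ) ∣ u := Int.natCast_dvd.2 hpu
  refine ⟨p, ?_, hp, N * y, hval ▸ Dvd.dvd.mul_left hpu' _⟩
  by_contra hle
  have h1 : (p : ℤ) ∣ (B.factorial : ℤ) :=
    Int.natCast_dvd_natCast.2 ((Nat.Prime.dvd_factorial hp).2 (not_lt.1 hle))
  have h2 : (p : ℤ) ∣ 1 := by
    have := dvd_sub hpu' (Dvd.dvd.mul_right h1 (y * w))
    rwa [hu, add_sub_cancel_right] at this
  exact (Nat.prime_iff_prime_int.1 hp).not_isUnit (isUnit_of_dvd_one h2)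

/-- An algebraic integer `t` can be specialized to an integer modulo arbitrarily large primes,
keeping a given polynomial expression nonzero. -/
theorem exists_prime_specialization {t : ℂ} (ht : IsIntegral ℤ t) {δ : ℤ[X]}
    (hδ : aeval t δ ≠ 0) (B : ℕ) :
    ∃ p : ℕ, B < p ∧ p.Prime ∧ ∃ a : ℤ, (∀ Q : ℤ[X], aeval t Q = 0 → (p : ℤ) ∣ Q.eval a) ∧
      ¬ (p : ℤ) ∣ δ.eval a := by
  set h := minpoly ℤ t with hh
  have hdeg : h.natDegree ≠ 0 := (minpoly.natDegree_pos ht).ne'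
  have hfrac : minpoly ℚ t = h.map (algebraMap ℤ ℚ) :=
    minpoly.isIntegrallyClosed_eq_field_fractions' ℚ ht
  have hcop : IsCoprime (h.map (algebraMap ℤ ℚ)) (δ.map (algebraMap ℤ ℚ)) := by
    rw [← hfrac, (minpoly.irreducible ht.tower_top).coprime_iff_not_dvd, minpoly.dvd_iff,
      aeval_map_algebraMap]
    exact hδ
  have hres : h.resultant δ ≠ 0 := by
    intro h0
    have h1 := resultant_map_map h δ h.natDegree δ.natDegree (algebraMap ℤ ℚ)
    rw [h0, map_zero] at h1
    have h2 : (h.map (algebraMap ℤ ℚ)).resultant (δ.map (algebraMap ℤ ℚ)) = 0 := by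
      rw [← h1]
      congr 1
      · exact natDegree_map_eq_of_injective (algebraMap ℤ ℚ).injective_int _
      · exact natDegree_map_eq_of_injective (algebraMap ℤ ℚ).injective_int _
    exact (resultant_eq_zero_iff.1 h2).2 hcop
  -- The resultant is a nonzero integer in the ideal generated by `h` and `δ`; a larger prime
  -- dividing `h a` cannot divide `δ a`.
  obtain ⟨u, v, -, -, huv⟩ :=
    exists_mul_add_mul_eq_C_resultant h δ le_rfl le_rfl (Or.inl hdeg)
  obtain ⟨p, hpB, hp, a, ha⟩ := exists_prime_gt_dvd_eval hdeg (max B (h.resultant δ).natAbs)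
  refine ⟨p, (le_max_left _ _).trans_lt hpB, hp, a, fun Q hQ => ?_, fun hpδ => ?_⟩
  · obtain ⟨w, hw⟩ := minpoly.isIntegrallyClosed_dvd ht hQ
    rw [hw, eval_mul]
    exact Dvd.dvd.mul_right ha _
  · have h1 := congrArg (fun q => q.eval a) huv
    simp only [eval_add, eval_mul, eval_C] at h1
    have h2 : (p : ℤ) ∣ h.resultant δ := by
      rw [← h1]
      exact dvd_add (Dvd.dvd.mul_right ha _) (Dvd.dvd.mul_right hpδ _)
    have h3 := Nat.le_of_dvd (Int.natAbs_pos.2 hres) (Int.natCast_dvd.1 h2)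
    exact absurd hpB (not_lt.2 (h3.trans (le_max_right _ _)))

/-- Every residue class at which a polynomial has a simple zero modulo `p` contains an integer at
which its value has `p`-adic order one. -/
theorem exists_not_sq_dvd_eval {p : ℕ} (hp : p.Prime) {Q : ℤ[X]} {a : ℤ}
    (hQ' : ¬ (p : ℤ) ∣ (derivative Q).eval a) :
    ∃ t : ℤ, (p : ℤ) ∣ t - a ∧ ¬ (p : ℤ) ^ 2 ∣ Q.eval t := by
  -- Replacing `a` by `a + p` changes the value by `p * Q' a` modulo `p ^ 2`, so one of the two
  -- works.
  by_cases h : (p : ℤ) ^ 2 ∣ Q.eval a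
  · refine ⟨a + p, by simp, fun h' => hQ' ?_⟩
    obtain ⟨z, hz⟩ := binomExpansion Q a p
    rw [hz] at h'
    have h1 : (p : ℤ) ^ 2 ∣ (derivative Q).eval a * p := by
      have h2 := dvd_sub (dvd_sub h' (Dvd.intro_left z rfl)) h
      ring_nf at h2 ⊢
      exact h2
    rw [pow_two] at h1
    exact Int.dvd_of_mul_dvd_mul_right (by exact_mod_cast hp.ne_zero) h1
  · exact ⟨a, by simp, h⟩

end Specialization

/-! ### Transferring the double root from `ℂ` to `ZMod p`. -/

section Transfer

/-- Separability of the specializations of a monic polynomial over a domain of characteristic zero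
is controlled by a single element. -/
theorem Polynomial.Monic.exists_separable_map {S : Type*} [CommRing S] [IsDomain S] [CharZero S]
    {Ψ : S[X]} (hΨ : Ψ.Monic) :
    ∃ ρ : S, (∀ {k : Type} [Field k] [CharZero k] (e : S →+* k), (Ψ.map e).Separable → e ρ ≠ 0) ∧
      ∀ {k : Type} [Field k] (e : S →+* k), e ρ ≠ 0 → (Ψ.map e).Separable := by
  by_cases hdeg : Ψ.natDegree = 0
  · have h1 : Ψ = 1 := hΨ.natDegree_eq_zero.1 hdeg
    exact ⟨1, fun e _ => by simp, fun e _ => by simp [h1, separable_one]⟩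
  -- In characteristic zero the derivative keeps its degree, so the resultant commutes with `e`. In
  -- general only the Bézout identity for the resultant is mapped.
  refine ⟨Ψ.resultant (derivative Ψ), fun {k} _ _ e hsep h0 => ?_, fun {k} _ e he => ?_⟩
  · have h1 := resultant_map_map Ψ (derivative Ψ) Ψ.natDegree (derivative Ψ).natDegree e
    rw [h0, ← derivative_map] at h1
    have h2 : (Ψ.map e).resultant (derivative (Ψ.map e)) = 0 := by
      rw [← h1]
      congr 1
      · exact hΨ.natDegree_map e
      · rw [natDegree_derivative, natDegree_derivative, hΨ.natDegree_map e]
    exact (resultant_eq_zero_iff.1 h2).2 hsep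
  · obtain ⟨u, v, -, -, huv⟩ :=
      exists_mul_add_mul_eq_C_resultant Ψ (derivative Ψ) le_rfl le_rfl (Or.inl hdeg)
    have h1 := congrArg (Polynomial.map e) huv
    rw [Polynomial.map_add, Polynomial.map_mul, Polynomial.map_mul, map_C, ← derivative_map] at h1
    refine ⟨C (e (Ψ.resultant (derivative Ψ)))⁻¹ * u.map e,
      C (e (Ψ.resultant (derivative Ψ)))⁻¹ * v.map e, ?_⟩
    calc _ = C (e (Ψ.resultant (derivative Ψ)))⁻¹ *
        (Ψ.map e * u.map e + derivative (Ψ.map e) * v.map e) := by ring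
      _ = 1 := by rw [h1, ← C_mul, inv_mul_cancel₀ he, C_1]

theorem Polynomial.Monic.divX {R : Type*} [CommRing R] {h : R[X]} (hh : h.Monic)
    (hdeg : h.natDegree ≠ 0) : h.divX.Monic := by
  rw [Polynomial.Monic, Polynomial.leadingCoeff, natDegree_divX_eq_natDegree_tsub_one, coeff_divX,
    Nat.sub_add_cancel (Nat.pos_of_ne_zero hdeg)]
  exact hh

/-- Over `ℤ[t]` this gives one cofactor to be specialized both to `ℂ` and to `ZMod p`; only the
constant term must vanish under specialization. -/
theorem eq_X_sq_mul_divX_divX {R : Type*} [CommRing R] {h : R[X]} (h1 : h.coeff 1 = 0) :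
    h = X ^ 2 * h.divX.divX + C (h.coeff 0) := by
  conv_lhs => rw [← divX_mul_X_add h, ← divX_mul_X_add h.divX]
  rw [coeff_divX, zero_add, h1, C_0]
  ring

theorem coeff_one_compIterate {R : Type*} [CommRing R] {f g : R[X]}
    (hf : (derivative f).eval 0 = 0) (m : ℕ) : (compIterate f g (m + 1)).coeff 1 = 0 := by
  have h := coeff_derivative (compIterate f g (m + 1)) 0
  rw [coeff_zero_eq_eval_zero, compIterate, derivative_comp, derivative_iterate_comp] at h
  simp only [eval_mul, eval_prod] at h
  rw [Finset.prod_eq_zero (Finset.mem_range.2 (Nat.succ_pos m)) (by simp [hf])] at h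
  simpa [compIterate] using h.symm

/-- The universal polynomial `F + t` over `ℤ[t]`. -/
noncomputable def genericTranslate (F : ℤ[X]) : ℤ[X][X] := F.map C + C X

theorem map_genericTranslate {k : Type*} [CommRing k] (F : ℤ[X]) (e : ℤ[X] →+* k) :
    (genericTranslate F).map e = F.map (Int.castRingHom k) + C (e X) := by
  rw [genericTranslate, Polynomial.map_add, Polynomial.map_map, map_C,
    Subsingleton.elim (e.comp C) (Int.castRingHom k)]

theorem map_compIterate_genericTranslate {k : Type*} [CommRing k] (F g : ℤ[X]) (e : ℤ[X] →+* k)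
    (m : ℕ) : (compIterate (genericTranslate F) (g.map C) m).map e =
      compIterate (F.map (Int.castRingHom k) + C (e X)) (g.map (Int.castRingHom k)) m := by
  rw [map_compIterate, map_genericTranslate, Polynomial.map_map,
    Subsingleton.elim (e.comp C) (Int.castRingHom k)]

theorem eval_map_castRingHom {k : Type*} [CommRing k] (e : ℤ[X] →+* k) (Q : ℤ[X]) :
    (Q.map (Int.castRingHom k)).eval (e X) = e Q := by
  conv_rhs => rw [← eval₂_C_X (p := Q), hom_eval₂]
  rw [eval_map, Subsingleton.elim (e.comp C) (Int.castRingHom k)]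

/-- Specializing a parameter for which the critical point `0` is periodic. -/
theorem exists_swapAt {F g g₁ : ℤ[X]} {d : ℕ} (hd : 2 ≤ d) (hFm : F.Monic)
    (hFd : F.natDegree = d) (hF0 : F.coeff 0 = 0) (hF : derivative F = C (d : ℤ) * g)
    (hgm : g.Monic) (hg : g = X * g₁) (hsep : (g.map (Int.castRingHom ℂ)).Separable)
    (hesc : ∀ (t : ℂ) (m : ℕ),
      (fun x => (F.map (Int.castRingHom ℂ) + C t).eval x)^[m + 1] 0 = 0 →
      ∀ α, α ≠ 0 → (g.map (Int.castRingHom ℂ)).eval α = 0 → ∀ l, (g.map (Int.castRingHom ℂ)).eval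
        ((fun x => (F.map (Int.castRingHom ℂ) + C t).eval x)^[l + 1] α) ≠ 0)
    (m B : ℕ) :
    ∃ p : ℕ, B < p ∧ p.Prime ∧ ∃ t : ℤ, SwapAt (compIterate (F + C t) g (m + 1)) p := by
  obtain ⟨t₀, hper, hexact⟩ := exists_exact_period hd hFm hFd hF0 hF m
  have hintegral : IsIntegral ℤ t₀ := ⟨_, (monic_critOrbit hFm (by omega) hF0 m).1, hper⟩
  have hgdeg : g.natDegree = d - 1 := by
    have := congrArg natDegree hF
    rwa [natDegree_derivative, hFd, natDegree_C_mul (by exact_mod_cast (by omega : d ≠ 0)),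
      eq_comm] at this
  have hg0 : g.eval 0 = 0 := by simp [hg]
  set Q := critOrbit F (m + 1) with hQ
  set f := genericTranslate F with hf
  set Γ := compIterate f (g.map C) (m + 1) with hΓ
  have hfm : f.Monic ∧ f.natDegree = d := by
    have h1 : (F.map (C : ℤ →+* ℤ[X])).natDegree = d := by rw [hFm.natDegree_map, hFd]
    have h2 : (C X : ℤ[X][X]).natDegree < (F.map (C : ℤ →+* ℤ[X])).natDegree := by
      rw [h1, natDegree_C]; omega
    exact ⟨(hFm.map C).add_of_left (degree_lt_degree h2), by
      rw [hf, genericTranslate, natDegree_add_eq_left_of_natDegree_lt h2, h1]⟩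
  have hd0 : f.natDegree ≠ 0 := by rw [hfm.2]; omega
  have hΓm : Γ.Monic := monic_compIterate hfm.1 (hgm.map C) hd0 _
  have hΓd : 2 ≤ Γ.natDegree := by
    rw [hΓ, natDegree_compIterate _ hfm.1 hd0, hfm.2, hgm.natDegree_map, hgdeg, pow_succ]
    have h1 : 1 ≤ d - 1 := by omega
    have h2 : 1 ≤ d ^ m := Nat.one_le_pow _ _ (by omega)
    calc 2 ≤ 1 * (1 * d) := by omega
      _ ≤ _ := Nat.mul_le_mul h1 (Nat.mul_le_mul_right _ h2)
  have hΨm : Γ.divX.divX.Monic := by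
    refine (hΓm.divX (by omega)).divX ?_
    rw [natDegree_divX_eq_natDegree_tsub_one]
    omega
  have hΓ1 : Γ.coeff 1 = 0 := by
    refine coeff_one_compIterate ?_ m
    rw [hf, genericTranslate, derivative_add, derivative_C, add_zero, derivative_map, hF]
    simp [hg]
  obtain ⟨ρ, hρ, hρ'⟩ := hΨm.exists_separable_map
  set Ψ := Γ.divX.divX with hΨ
  -- The constant term is `g` evaluated at the critical orbit `Q`, and `g` vanishes at `0`.
  have hfac : ∀ {k : Type} [Field k] (e : ℤ[X] →+* k), e Q = 0 →
      compIterate (F.map (Int.castRingHom k) + C (e X)) (g.map (Int.castRingHom k)) (m + 1) =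
        X ^ 2 * Ψ.map e := by
    intro k _ e he
    have h0 : e (Γ.coeff 0) = 0 := by
      rw [← coeff_map, coeff_zero_eq_eval_zero, hΓ, hf, map_compIterate_genericTranslate,
        eval_compIterate, ← eval_map_critOrbit, ← hQ, eval_map_castRingHom, he]
      simp [hg]
    rw [← map_compIterate_genericTranslate, ← hf, ← hΓ, eq_X_sq_mul_divX_divX hΓ1,
      Polynomial.map_add, map_C, h0]
    simp [hΨ]
  set e₀ : ℤ[X] →+* ℂ := (aeval t₀ : ℤ[X] →ₐ[ℤ] ℂ).toRingHom with he₀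
  have he₀X : e₀ X = t₀ := aeval_X t₀
  have horb : ∀ l, (fun x => (F.map (Int.castRingHom ℂ) + C t₀).eval x)^[l] 0 =
      aeval t₀ (critOrbit F l) := fun l => by
    rw [← eval_map_critOrbit, ← he₀X, eval_map_castRingHom, he₀X]
    rfl
  have hper' := (horb (m + 1)).trans hper
  obtain ⟨hΨs, hΨ0⟩ : (Ψ.map e₀).Separable ∧ (Ψ.map e₀).eval 0 ≠ 0 := by
    have hfac₀ := hfac e₀ hper
    rw [he₀X] at hfac₀
    refine compIterate_eq_X_sq_mul (d := (d : ℂ)) (g₁ := g₁.map (Int.castRingHom ℂ))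
      (by exact_mod_cast (by omega : d ≠ 0)) ?_ ?_ hsep hper' (fun l hl => ?_) (hesc t₀ m hper')
      hfac₀
    · rw [derivative_add, derivative_C, add_zero, derivative_map, hF]
      simp
    · rw [hg]; simp
    · rw [horb]
      exact hexact l hl
  have hQ' : aeval t₀ (derivative Q) ≠ 0 := by
    have h1 : (Q.map (Int.castRingHom ℂ)).Separable :=
      separable_map_critOrbit hd hFm hFd hF0 hF m
    have h2 := h1.eval₂_derivative_ne_zero (RingHom.id ℂ) (x := e₀ X)
      (by rw [← eval_map, Polynomial.map_id, eval_map_castRingHom]; exact hper)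
    rw [← eval_map, Polynomial.map_id, derivative_map, eval_map_castRingHom] at h2
    exact h2
  have hg₁ : g₁.coeff 0 ≠ 0 := by
    intro h0
    have h1 := hsep.eval₂_derivative_ne_zero (RingHom.id ℂ) (x := 0) (by simp [hg])
    refine h1 ?_
    have h2 : g₁.eval 0 = 0 := by rw [← coeff_zero_eq_eval_zero, h0]
    rw [← eval_map, Polynomial.map_id, derivative_map, hg]
    simp [← coeff_zero_eq_eval_zero, coeff_map, h0]
  -- Modulo `p` the three factors ensure a separable cofactor, its nonvanishing at `0`, and a simple
  -- zero of `Q`.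
  have hδ : aeval t₀ (ρ * Ψ.coeff 0 * derivative Q) ≠ 0 := by
    rw [map_mul, map_mul]
    refine mul_ne_zero (mul_ne_zero (hρ e₀ hΨs) ?_) hQ'
    rwa [← coeff_zero_eq_eval_zero, coeff_map] at hΨ0
  -- The bound `p > |g₁ 0|` makes `g (Q t) = Q t * g₁ (Q t)` have the same `p`-adic order as `Q t`.
  obtain ⟨p, hpB, hp, a, ha, hδa⟩ :=
    exists_prime_specialization hintegral hδ (max B (g₁.coeff 0).natAbs)
  have hpr := Nat.prime_iff_prime_int.1 hp
  simp only [eval_mul, hpr.dvd_mul, not_or] at hδa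
  obtain ⟨t, hta, htQ⟩ := exists_not_sq_dvd_eval hp hδa.2
  have hdvd : ∀ h : ℤ[X], (p : ℤ) ∣ h.eval t ↔ (p : ℤ) ∣ h.eval a := fun h =>
    dvd_iff_dvd_of_dvd_sub (hta.trans (sub_dvd_eval_sub t a h))
  have hQt : (p : ℤ) ∣ Q.eval t := (hdvd Q).2 (ha Q hper)
  have : Fact p.Prime := ⟨hp⟩
  set e : ℤ[X] →+* ZMod p := (Int.castRingHom (ZMod p)).comp (evalRingHom t) with he
  have he0 : ∀ h : ℤ[X], e h = 0 ↔ (p : ℤ) ∣ h.eval t := fun h =>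
    ZMod.intCast_zmod_eq_zero_iff_dvd _ p
  have heX : e X = (t : ZMod p) := by simp [he]
  refine ⟨p, (le_max_left _ _).trans_lt hpB, hp, t, Ψ.map e, ?_, ?_, ?_, ?_⟩
  · rw [← hfac e ((he0 Q).2 hQt), map_compIterate, heX]
    simp
  · exact hρ' e fun h => hδa.1.1 ((hdvd ρ).1 ((he0 ρ).1 h))
  · rw [← coeff_zero_eq_eval_zero, coeff_map]
    exact fun h => hδa.1.2 ((hdvd _).1 ((he0 _).1 h))
  · have horbZ := eval_map_critOrbit F (m + 1) t
    rw [Int.castRingHom_int, Polynomial.map_id, Polynomial.map_id, ← hQ] at horbZ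
    rw [coeff_zero_eq_eval_zero, eval_compIterate, ← horbZ, hg, eval_mul, eval_X]
    intro h
    have hng : ¬ (p : ℤ) ∣ g₁.eval (Q.eval t) := by
      intro h1
      have h2 : (p : ℤ) ∣ g₁.coeff 0 := by
        have h3 := sub_dvd_eval_sub (Q.eval t) 0 g₁
        rw [sub_zero, ← coeff_zero_eq_eval_zero] at h3
        exact (dvd_iff_dvd_of_dvd_sub (hQt.trans h3)).1 h1
      have h4 := Nat.le_of_dvd (Int.natAbs_pos.2 hg₁) (Int.natCast_dvd.1 h2)
      exact absurd hpB (not_lt.2 (h4.trans (le_max_right _ _)))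
    exact htQ (hpr.pow_dvd_of_dvd_mul_right 2 hng h)

end Transfer

/-! ### Families whose nonzero critical points escape. -/

section Escape

/-- If all nonzero critical points escape whenever the parameter is small, they escape for every
parameter such that the critical point `0` is periodic. -/
theorem eval_iterate_ne_zero_of_escape {F g : ℂ[X]} {T : ℝ} (hT : 0 < T) (hF0 : F.eval 0 = 0)
    (hgrow : ∀ x t : ℂ, T ≤ ‖x‖ → ‖t‖ ≤ ‖x‖ → ‖x‖ ≤ ‖F.eval x + t‖)
    (hcrit : ∀ α, α ≠ 0 → g.eval α = 0 → ‖α‖ < T ∧ 2 * T ≤ ‖F.eval α‖)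
    {t : ℂ} {m : ℕ} (hper : (fun x => (F + C t).eval x)^[m + 1] 0 = 0) {α : ℂ} (hα : α ≠ 0)
    (hgα : g.eval α = 0) (l : ℕ) : g.eval ((fun x => (F + C t).eval x)^[l + 1] α) ≠ 0 := by
  set φ : ℂ → ℂ := fun x => (F + C t).eval x with hφ
  have hφx : ∀ x, φ x = F.eval x + t := fun x => by simp [hφ]
  have hiter : ∀ x, T ≤ ‖x‖ → ‖t‖ ≤ ‖x‖ → ∀ l, ‖x‖ ≤ ‖φ^[l] x‖ := by
    intro x hx ht l
    induction l with
    | zero => simp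
    | succ l ih =>
      rw [Function.iterate_succ_apply', hφx]
      exact ih.trans (hgrow _ t (hx.trans ih) (ht.trans ih))
  -- `t` is the image of `0`; if it were large, its orbit could not return to `0`.
  have ht : ‖t‖ < T := by
    by_contra! h
    have h1 := hiter t h le_rfl m
    rw [Function.iterate_succ_apply, hφx, hF0, zero_add] at hper
    rw [hper, norm_zero] at h1
    linarith
  have h1 : T ≤ ‖φ α‖ := by
    have h2 := norm_sub_le (φ α) t
    rw [hφx, add_sub_cancel_right, ← hφx] at h2
    linarith [(hcrit α hα hgα).2]
  have h2 : T ≤ ‖φ^[l + 1] α‖ := by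
    rw [Function.iterate_succ_apply]
    exact h1.trans (hiter _ h1 (ht.le.trans h1) l)
  intro h3
  refine absurd (hcrit _ ?_ h3).1 (not_lt.2 h2)
  intro h4
  rw [h4, norm_zero] at h2
  linarith

/-- `0` is the only critical point, so there is nothing that has to escape. -/
theorem exists_swapAt_quadratic (m B : ℕ) :
    ∃ p : ℕ, B < p ∧ p.Prime ∧ ∃ t : ℤ, SwapAt (compIterate (X ^ 2 + C t) X (m + 1)) p := by
  refine exists_swapAt (g₁ := 1) (d := 2) le_rfl (monic_X_pow 2) (natDegree_X_pow 2) (by simp)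
    (by simp) monic_X (by simp) (by simpa using separable_X) ?_ m B
  intro t m hper α hα hgα
  exact absurd (by simpa using hgα) hα

/-- With `2 * b = 4 ^ (d - 2)` the nonzero critical points satisfy `α ^ (d - 2) = -2 * b`, so they
have absolute value `4`, whereas `F α = (d - 2) * b * α ^ 2` is beyond twice the escape radius. -/
theorem exists_swapAt_trinomial {d : ℕ} (hd : 3 ≤ d) (m B : ℕ) :
    ∃ b : ℤ, ∃ p : ℕ, B < p ∧ p.Prime ∧ ∃ t : ℤ,
      SwapAt (compIterate (X ^ d + C (d * b) * X ^ 2 + C t)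
        (X ^ (d - 1) + C (2 * b) * X) (m + 1)) p := by
  obtain ⟨e, rfl⟩ : ∃ e, d = e + 3 := ⟨d - 3, by omega⟩
  simp only [show e + 3 - 1 = e + 2 by omega]
  set b : ℤ := 2 * 4 ^ e with hb
  have hb2 : 2 * (b : ℂ) = 4 ^ (e + 1) := by rw [hb]; push_cast; ring
  have hbpos : (2 : ℝ) ≤ b := by
    rw [hb]; push_cast
    linarith [one_le_pow₀ (show (1 : ℝ) ≤ 4 by norm_num) (n := e)]
  have hlt : (C (((e + 3 : ℕ) : ℤ) * b) * X ^ 2 : ℤ[X]).degree < (X ^ (e + 3) : ℤ[X]).degree := by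
    rw [degree_X_pow]
    refine (degree_C_mul_X_pow_le _ _).trans_lt ?_
    exact_mod_cast (by omega : 2 < e + 3)
  have hlt' : (C (2 * b) * X : ℤ[X]).degree < (X ^ (e + 2) : ℤ[X]).degree := by
    rw [degree_X_pow]
    refine (degree_C_mul_X_le _).trans_lt ?_
    exact_mod_cast (by omega : 1 < e + 2)
  refine ⟨b, exists_swapAt (g₁ := X ^ (e + 1) + C (2 * b)) (d := e + 3) (by omega)
    ((monic_X_pow _).add_of_left hlt) ?_ ?_ ?_ ((monic_X_pow _).add_of_left hlt') ?_ ?_ ?_ m B⟩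
  · rw [natDegree_add_eq_left_of_degree_lt hlt, natDegree_X_pow]
  · simp [coeff_X_pow]
  · simp only [derivative_add, derivative_X_pow, C_mul]
    simp
    ring
  · ring
  · have h1 : ((X ^ (e + 2) + C (2 * b) * X : ℤ[X]).map (Int.castRingHom ℂ)) =
        X * (X ^ (e + 1) - C (-(2 * b : ℂ))) := by
      rw [Polynomial.map_add, Polynomial.map_mul, Polynomial.map_pow, map_X, map_C,
        eq_intCast (Int.castRingHom ℂ), Int.cast_mul, Int.cast_ofNat, C_neg]
      ring
    have hb0 : (-(2 * b : ℂ)) ≠ 0 := by rw [hb2]; exact neg_ne_zero.2 (pow_ne_zero _ (by norm_num))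
    rw [h1]
    refine separable_X.mul (separable_X_pow_sub_C _ (by exact_mod_cast (Nat.succ_ne_zero e)) hb0) ?_
    refine (isCoprime_iff_aeval_ne_zero_of_isAlgClosed ℂ ℂ _ _).2 fun x => ?_
    by_cases hx : x = 0
    · right
      simpa [hx] using hb0
    · left
      simpa using hx
  · intro t m hper α hα hgα
    have hF : ∀ x : ℂ, ((X ^ (e + 3) + C (((e + 3 : ℕ) : ℤ) * b) * X ^ 2 : ℤ[X]).map
        (Int.castRingHom ℂ)).eval x = x ^ (e + 3) + ((e + 3 : ℕ) : ℂ) * b * x ^ 2 := fun x => by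
      simp
    -- For `‖x‖ ≥ T` the leading term is at least `T * ‖x‖ ^ 2`; the `+ 2` leaves `2 * ‖x‖ ^ 2`
    -- after the quadratic term, enough to absorb `t` and keep `‖x‖`.
    refine eval_iterate_ne_zero_of_escape (T := (e + 3) * b + 2) (by positivity) ?_ ?_ ?_
      hper hα hgα
    · rw [hF]; simp
    · intro x t hx ht
      rw [hF]
      have h1 : ‖x‖ ^ (e + 3) ≤ ‖x ^ (e + 3) + ((e + 3 : ℕ) : ℂ) * b * x ^ 2 + t‖ +
          (e + 3) * b * ‖x‖ ^ 2 + ‖t‖ := by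
        have h2 := norm_sub_le (x ^ (e + 3) + ((e + 3 : ℕ) : ℂ) * b * x ^ 2 + t)
          (((e + 3 : ℕ) : ℂ) * b * x ^ 2 + t)
        have h3 := norm_add_le (((e + 3 : ℕ) : ℂ) * b * x ^ 2) t
        have h4 : ‖((e + 3 : ℕ) : ℂ) * b * x ^ 2‖ = (e + 3) * b * ‖x‖ ^ 2 := by
          rw [norm_mul, norm_mul, norm_pow, Complex.norm_natCast, Complex.norm_intCast,
            abs_of_nonneg (by linarith)]
          push_cast; ring
        rw [show x ^ (e + 3) + ((e + 3 : ℕ) : ℂ) * b * x ^ 2 + t -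
          (((e + 3 : ℕ) : ℂ) * b * x ^ 2 + t) = x ^ (e + 3) by ring, norm_pow] at h2
        rw [h4] at h3
        linarith
      have he : (0 : ℝ) ≤ e := Nat.cast_nonneg e
      have h2x : 2 ≤ ‖x‖ := by nlinarith
      have h5 : ‖x‖ ^ 3 ≤ ‖x‖ ^ (e + 3) := pow_le_pow_right₀ (by linarith) (by omega)
      have h6 : ((e + 3) * b + 2) * ‖x‖ ^ 2 ≤ ‖x‖ ^ 3 := by
        rw [pow_succ' ‖x‖ 2]
        exact mul_le_mul_of_nonneg_right hx (by positivity)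
      nlinarith
    · intro α hα hgα
      have h1 : α ^ (e + 1) = -(2 * b) := by
        have h2 : α * (α ^ (e + 1) + 2 * b) = 0 := by
          rw [← hgα]; simp; ring
        exact eq_neg_of_add_eq_zero_left ((mul_eq_zero.1 h2).resolve_left hα)
      have h2 : ‖α‖ = 4 := by
        have h3 := congrArg norm h1
        rw [hb2, norm_neg, norm_pow, norm_pow] at h3
        have := (pow_left_inj₀ (norm_nonneg _) (norm_nonneg _) (Nat.succ_ne_zero e)).1 h3
        rw [this]; norm_num
      have he : (0 : ℝ) ≤ e := Nat.cast_nonneg e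
      refine ⟨by rw [h2]; nlinarith, ?_⟩
      rw [hF, show α ^ (e + 3) + ((e + 3 : ℕ) : ℂ) * b * α ^ 2 = ((e + 1 : ℕ) : ℂ) * b * α ^ 2 by
        rw [pow_add _ (e + 1) 2, h1]; push_cast; ring, norm_mul, norm_mul, norm_pow, h2,
        Complex.norm_natCast, Complex.norm_intCast, abs_of_nonneg (by linarith)]
      push_cast
      nlinarith

end Escape

/-! ### The polynomial family and residue classes of coefficients. -/

section Family

theorem C_dvd_sub_iff_map_eq {N : ℕ} {a b : ℤ[X]} :
    C (N : ℤ) ∣ a - b ↔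
      a.map (Int.castRingHom (ZMod N)) = b.map (Int.castRingHom (ZMod N)) := by
  rw [C_dvd_iff_dvd_coeff, Polynomial.ext_iff]
  refine forall_congr' fun i => ?_
  rw [coeff_map, coeff_map, eq_intCast, eq_intCast, eq_comm, ZMod.intCast_eq_intCast_iff_dvd_sub,
    coeff_sub]

theorem map_eq_map_of_sq_dvd {p : ℕ} {a b : ℤ[X]} (h : C ((p : ℤ) ^ 2) ∣ a - b) :
    a.map (Int.castRingHom (ZMod p)) = b.map (Int.castRingHom (ZMod p)) :=
  C_dvd_sub_iff_map_eq.1 (dvd_trans (by rw [C_pow]; exact dvd_pow_self _ two_ne_zero) h)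

theorem dvd_coeff_iff_of_C_dvd_sub {k : ℤ} {a b : ℤ[X]} (h : C k ∣ a - b) (i : ℕ) :
    k ∣ a.coeff i ↔ k ∣ b.coeff i :=
  dvd_iff_dvd_of_dvd_sub (by simpa using (C_dvd_iff_dvd_coeff _ _).1 h i)

theorem TransitiveAt.congr {d q : ℕ} {f g f' g' : ℤ[X]} (h : TransitiveAt d f g q)
    (hf : C ((q : ℤ) ^ 2) ∣ f' - f) (hg : C ((q : ℤ) ^ 2) ∣ g' - g) : TransitiveAt d f' g' q where
  map_f := (map_eq_map_of_sq_dvd hf).trans h.map_f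
  map_g := (map_eq_map_of_sq_dvd hg).trans h.map_g
  dvd_f := (dvd_coeff_iff_of_C_dvd_sub hf 0).2 h.dvd_f
  not_dvd_g := mt (dvd_coeff_iff_of_C_dvd_sub hg 0).1 h.not_dvd_g

theorem DoublyTransitiveAt.congr {d r : ℕ} {f g f' g' : ℤ[X]} (h : DoublyTransitiveAt d f g r)
    (hf : C ((r : ℤ) ^ 2) ∣ f' - f) (hg : C ((r : ℤ) ^ 2) ∣ g' - g) :
    DoublyTransitiveAt d f' g' r where
  map_f := (map_eq_map_of_sq_dvd hf).trans h.map_f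
  map_g := (map_eq_map_of_sq_dvd hg).trans h.map_g
  not_dvd := h.not_dvd
  not_dvd_pred := h.not_dvd_pred
  dvd_f := (dvd_coeff_iff_of_C_dvd_sub hf 0).2 h.dvd_f
  not_dvd_g := mt (dvd_coeff_iff_of_C_dvd_sub hg 0).1 h.not_dvd_g

theorem SwapAt.congr {p : ℕ} {h h' : ℤ[X]} (hh : SwapAt h p) (hd : C ((p : ℤ) ^ 2) ∣ h' - h) :
    SwapAt h' p := by
  obtain ⟨Ψ, h1, h2, h3, h4⟩ := hh
  exact ⟨Ψ, (map_eq_map_of_sq_dvd hd).trans h1, h2, h3,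
    mt (dvd_coeff_iff_of_C_dvd_sub hd 0).1 h4⟩

theorem C_dvd_compIterate_sub {N : ℕ} {f g f' g' : ℤ[X]} (hf : C (N : ℤ) ∣ f' - f)
    (hg : C (N : ℤ) ∣ g' - g) (m : ℕ) : C (N : ℤ) ∣ compIterate f' g' m - compIterate f g m := by
  rw [C_dvd_sub_iff_map_eq] at *
  rw [map_compIterate, map_compIterate, hf, hg]

/-- The terms of degree less than `d` of the polynomial of the family attached to `h`. -/
noncomputable def lowerPart (d : ℕ) (h : ℤ[X]) : ℤ[X] :=
  C (h.coeff 0) + C (d : ℤ) * (h - C (h.coeff 0))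

/-- A family of monic polynomials of degree `d` whose derivatives are divisible by `d`. -/
noncomputable def familyPoly (d : ℕ) (h : ℤ[X]) : ℤ[X] := X ^ d + lowerPart d h

/-- The derivative of `familyPoly d h`, divided by `d`. -/
noncomputable def familyDeriv (d : ℕ) (h : ℤ[X]) : ℤ[X] := X ^ (d - 1) + derivative h

theorem derivative_familyPoly (d : ℕ) (h : ℤ[X]) :
    derivative (familyPoly d h) = C (d : ℤ) * familyDeriv d h := by
  simp [familyPoly, familyDeriv, lowerPart, derivative_X_pow]
  ring

theorem degree_lowerPart_lt {d : ℕ} (hd : d ≠ 0) {h : ℤ[X]} (hh : h.degree < d) :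
    (lowerPart d h).degree < d := by
  have h0 : ∀ c : ℤ, (C c : ℤ[X]).degree < d := fun c =>
    degree_C_le.trans_lt (by exact_mod_cast Nat.pos_of_ne_zero hd)
  refine (degree_add_le _ _).trans_lt (max_lt (h0 _) ?_)
  rw [← smul_eq_C_mul]
  exact (degree_smul_le _ _).trans_lt ((degree_sub_le _ _).trans_lt (max_lt hh (h0 _)))

theorem coeff_lowerPart (d : ℕ) (h : ℤ[X]) (i : ℕ) :
    (lowerPart d h).coeff i = (if i = 0 then 1 else (d : ℤ)) * h.coeff i := by
  rcases eq_or_ne i 0 with rfl | hi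
  · simp [lowerPart]
  · rw [lowerPart, coeff_add, coeff_C_mul, coeff_sub, coeff_C_of_ne_zero hi, if_neg hi, zero_add,
      sub_zero]

theorem monic_familyPoly {d : ℕ} (hd : d ≠ 0) {h : ℤ[X]} (hh : h.degree < d) :
    (familyPoly d h).Monic ∧ (familyPoly d h).natDegree = d := by
  have h1 : (lowerPart d h).degree < (X ^ d : ℤ[X]).degree := by
    rw [degree_X_pow]; exact degree_lowerPart_lt hd hh
  refine ⟨(monic_X_pow d).add_of_left h1, ?_⟩
  rw [familyPoly, natDegree_add_eq_left_of_degree_lt h1, natDegree_X_pow]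

theorem monic_familyDeriv {d : ℕ} (hd : 2 ≤ d) {h : ℤ[X]} (hh : h.degree < d) :
    (familyDeriv d h).Monic ∧ (familyDeriv d h).natDegree = d - 1 := by
  have h1 : (derivative h).degree < (X ^ (d - 1) : ℤ[X]).degree := by
    rw [degree_X_pow]
    by_cases h0 : h.natDegree = 0
    · rw [derivative_of_natDegree_zero h0, degree_zero]
      exact WithBot.bot_lt_coe _
    · have h2 : h.natDegree < d := (natDegree_lt_iff_degree_lt (by rintro rfl; simp at h0)).2 hh
      refine degree_le_natDegree.trans_lt ?_
      have := natDegree_derivative_lt h0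
      exact_mod_cast (by omega : (derivative h).natDegree < d - 1)
  refine ⟨(monic_X_pow _).add_of_left h1, ?_⟩
  rw [familyDeriv, natDegree_add_eq_left_of_degree_lt h1, natDegree_X_pow]

theorem C_dvd_familyPoly_sub {k : ℤ} {h h' : ℤ[X]} (hk : C k ∣ h' - h) (d : ℕ) :
    C k ∣ familyPoly d h' - familyPoly d h := by
  rw [familyPoly, familyPoly, add_sub_add_left_eq_sub, C_dvd_iff_dvd_coeff]
  intro i
  rw [coeff_sub, coeff_lowerPart, coeff_lowerPart, ← mul_sub, ← coeff_sub]
  exact Dvd.dvd.mul_left ((C_dvd_iff_dvd_coeff _ _).1 hk i) _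

theorem C_dvd_familyDeriv_sub {k : ℤ} {h h' : ℤ[X]} (hk : C k ∣ h' - h) (d : ℕ) :
    C k ∣ familyDeriv d h' - familyDeriv d h := by
  obtain ⟨w, hw⟩ := hk
  rw [familyDeriv, familyDeriv, add_sub_add_left_eq_sub, ← derivative_sub, hw, derivative_C_mul]
  exact dvd_mul_right _ _

/-- A property of integral polynomials of degree less than `d` which holds on a full residue
class, for moduli with arbitrarily large prime factors. -/
def HoldsOnResidueClass (d : ℕ) (P : ℤ[X] → Prop) : Prop :=
  ∀ B : ℕ, ∃ N : ℕ, N ≠ 0 ∧ (∀ p : ℕ, p.Prime → p ∣ N → B < p) ∧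
    ∃ h₀ : ℤ[X], h₀.degree < d ∧ ∀ h : ℤ[X], C (N : ℤ) ∣ h - h₀ → P h

/-- Chinese remainder theorem. Demanding prime factors of the second modulus above `N` makes the
moduli coprime, which is why the definition quantifies over `B`. -/
theorem HoldsOnResidueClass.and {d : ℕ} {P Q : ℤ[X] → Prop} (hP : HoldsOnResidueClass d P)
    (hQ : HoldsOnResidueClass d Q) : HoldsOnResidueClass d fun h => P h ∧ Q h := by
  intro B
  obtain ⟨N, hN, hNB, h₁, hd₁, hP⟩ := hP B
  obtain ⟨M, hM, hMB, h₂, hd₂, hQ⟩ := hQ (max B N)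
  have hcop : IsCoprime (N : ℤ) (M : ℤ) := by
    rw [Nat.isCoprime_iff_coprime]
    refine Nat.coprime_of_dvd fun p hp hpN hpM => ?_
    exact absurd ((le_max_right _ _).trans_lt (hMB p hp hpM))
      (not_lt.2 (Nat.le_of_dvd (Nat.pos_of_ne_zero hN) hpN))
  obtain ⟨u, v, huv⟩ := hcop
  have huv' : C u * C (N : ℤ) + C v * C (M : ℤ) = 1 := by
    rw [← C_mul, ← C_mul, ← C_add, huv, C_1]
  refine ⟨N * M, mul_ne_zero hN hM, fun p hp hpd => ?_, C (u * N) * h₂ + C (v * M) * h₁, ?_,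
    fun h hh => ⟨hP h ?_, hQ h ?_⟩⟩
  · rcases hp.dvd_mul.1 hpd with h | h
    · exact hNB p hp h
    · exact (le_max_left _ _).trans_lt (hMB p hp h)
  · rw [← smul_eq_C_mul, ← smul_eq_C_mul]
    exact (degree_add_le _ _).trans_lt (max_lt ((degree_smul_le _ _).trans_lt hd₂)
      ((degree_smul_le _ _).trans_lt hd₁))
  · have h1 : C (N : ℤ) ∣ h - (C (u * N) * h₂ + C (v * M) * h₁) :=
      dvd_trans (by push_cast; rw [C_mul]; exact dvd_mul_right _ _) hh
    have h2 : h - h₁ = (h - (C (u * N) * h₂ + C (v * M) * h₁)) + C (N : ℤ) * (C u * (h₂ - h₁)) := by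
      rw [C_mul, C_mul]
      linear_combination h₁ * huv'
    rw [h2]
    exact dvd_add h1 (dvd_mul_right _ _)
  · have h1 : C (M : ℤ) ∣ h - (C (u * N) * h₂ + C (v * M) * h₁) :=
      dvd_trans (by push_cast; rw [C_mul]; exact dvd_mul_left _ _) hh
    have h2 : h - h₂ = (h - (C (u * N) * h₂ + C (v * M) * h₁)) + C (M : ℤ) * (C v * (h₁ - h₂)) := by
      rw [C_mul, C_mul]
      linear_combination h₂ * huv'
    rw [h2]
    exact dvd_add h1 (dvd_mul_right _ _)

theorem HoldsOnResidueClass.mono {d : ℕ} {P Q : ℤ[X] → Prop} (hP : HoldsOnResidueClass d P)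
    (h : ∀ h, P h → Q h) : HoldsOnResidueClass d Q := fun B => by
  obtain ⟨N, hN, hNB, h₀, hd₀, hP⟩ := hP B
  exact ⟨N, hN, hNB, h₀, hd₀, fun h' hh => h h' (hP h' hh)⟩

theorem holdsOnResidueClass_of_forall {d : ℕ} {P : ℤ[X] → Prop} (h : ∀ h, P h) :
    HoldsOnResidueClass d P := fun B =>
  ⟨1, one_ne_zero, fun _ hp h1 => absurd (Nat.dvd_one.1 h1) hp.ne_one, 0,
    by rw [degree_zero]; exact WithBot.bot_lt_coe _, fun h' _ => h h'⟩

theorem HoldsOnResidueClass.forall_le {d : ℕ} {P : ℕ → ℤ[X] → Prop}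
    (hP : ∀ m, HoldsOnResidueClass d (P m)) (n : ℕ) :
    HoldsOnResidueClass d fun h => ∀ m ≤ n, P m h := by
  induction n with
  | zero => simpa using hP 0
  | succ n ih =>
    simpa only [Nat.le_succ_iff_eq_or_le, forall_eq_or_imp] using (hP (n + 1)).and ih

/-- One example at each of arbitrarily large primes suffices: the class is taken modulo `p ^ 2`, and
`p > |D|` keeps `p` from dividing `D`, later the discriminant of `K`. -/
theorem holdsOnResidueClass_of_prime {d : ℕ} {P : ℕ → ℤ[X] → Prop}
    (hP : ∀ (p : ℕ) (h h' : ℤ[X]), C ((p : ℤ) ^ 2) ∣ h' - h → P p h → P p h')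
    (hex : ∀ B : ℕ, ∃ p : ℕ, B < p ∧ p.Prime ∧ ∃ h : ℤ[X], h.degree < d ∧ P p h)
    {D : ℤ} (hD : D ≠ 0) :
    HoldsOnResidueClass d fun h => ∃ p : ℕ, p.Prime ∧ ¬ (p : ℤ) ∣ D ∧ P p h := by
  intro B
  obtain ⟨p, hpB, hp, h₀, hd₀, hp₀⟩ := hex (max B D.natAbs)
  refine ⟨p ^ 2, pow_ne_zero _ hp.ne_zero, fun q hq hqp => ?_, h₀, hd₀, fun h hh => ⟨p, hp, ?_,
    hP p h₀ h (by exact_mod_cast hh) hp₀⟩⟩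
  · rw [(Nat.prime_dvd_prime_iff_eq hq hp).1 (hq.dvd_of_dvd_pow hqp)]
    exact (le_max_left _ _).trans_lt hpB
  · intro h1
    have h2 := Nat.le_of_dvd (Int.natAbs_pos.2 hD) (Int.natCast_dvd.1 h1)
    exact absurd hpB (not_lt.2 (h2.trans (le_max_right _ _)))

end Family

/-! ### Members of the family satisfying each local condition. -/

section Examples

theorem familyPoly_of_coeff_zero (d : ℕ) {h : ℤ[X]} (h0 : h.coeff 0 = 0) :
    familyPoly d h = X ^ d + C (d : ℤ) * h := by
  rw [familyPoly, lowerPart, h0, C_0, zero_add, sub_zero]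

theorem Nat.Prime.not_sq_dvd_self {p : ℕ} (hp : p.Prime) : ¬ (p : ℤ) ^ 2 ∣ p := fun h => by
  have h1 : p ^ 2 ∣ p := by exact_mod_cast h
  have h2 := Nat.le_of_dvd hp.pos h1
  nlinarith [hp.two_le]

/-- The example is `f = X ^ d + d * q * X`, with `g = X ^ (d - 1) + q`. -/
theorem holdsOnResidueClass_transitiveAt {d : ℕ} (hd : 2 ≤ d) {D : ℤ} (hD : D ≠ 0) :
    HoldsOnResidueClass d fun h => ∃ q : ℕ, q.Prime ∧ ¬ (q : ℤ) ∣ D ∧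
      TransitiveAt d (familyPoly d h) (familyDeriv d h) q := by
  refine holdsOnResidueClass_of_prime
    (fun p h h' hh hp => hp.congr (C_dvd_familyPoly_sub hh d) (C_dvd_familyDeriv_sub hh d))
    (fun B => ?_) hD
  obtain ⟨q, hqB, hq⟩ := Nat.exists_infinite_primes (B + 1)
  have hf : familyPoly d (C (q : ℤ) * X) = X ^ d + C (d : ℤ) * (C (q : ℤ) * X) :=
    familyPoly_of_coeff_zero d (by simp)
  have hg : familyDeriv d (C (q : ℤ) * X) = X ^ (d - 1) + C (q : ℤ) := by
    rw [familyDeriv, derivative_C_mul, derivative_X, mul_one]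
  have hC : (C (q : ℤ)).map (Int.castRingHom (ZMod q)) = 0 := by
    rw [map_C, eq_intCast, Int.cast_natCast, CharP.cast_eq_zero, C_0]
  refine ⟨q, hqB, hq, C (q : ℤ) * X, (degree_C_mul_X_le _).trans_lt (by exact_mod_cast hd), ?_, ?_,
    ?_, ?_⟩
  · rw [hf, Polynomial.map_add, Polynomial.map_mul, Polynomial.map_mul, hC, zero_mul, mul_zero,
      add_zero]
  · rw [hg, Polynomial.map_add, hC, add_zero]
  · rw [hf]
    simp [coeff_X_pow, show (0 : ℕ) ≠ d by omega]
  · rw [hg, coeff_add, coeff_X_pow, if_neg (by omega), zero_add, coeff_C_zero]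
    exact hq.not_sq_dvd_self

/-- The example is `f = X ^ (d - 1) * (X - d) + d * r * X`, with `g = X ^ (d - 2) * (X - (d - 1)) +
r`. -/
theorem holdsOnResidueClass_doublyTransitiveAt {d : ℕ} (hd : 3 ≤ d) {D : ℤ} (hD : D ≠ 0) :
    HoldsOnResidueClass d fun h => ∃ r : ℕ, r.Prime ∧ ¬ (r : ℤ) ∣ D ∧
      DoublyTransitiveAt d (familyPoly d h) (familyDeriv d h) r := by
  refine holdsOnResidueClass_of_prime
    (fun p h h' hh hp => hp.congr (C_dvd_familyPoly_sub hh d) (C_dvd_familyDeriv_sub hh d))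
    (fun B => ?_) hD
  obtain ⟨r, hrB, hr⟩ := Nat.exists_infinite_primes (max B d + 1)
  obtain ⟨e, rfl⟩ : ∃ e, d = e + 3 := ⟨d - 3, by omega⟩
  have hrd : e + 3 < r := (le_max_right _ _).trans_lt hrB
  set h : ℤ[X] := C (r : ℤ) * X - X ^ (e + 2) with hh
  have hf : familyPoly (e + 3) h = X ^ (e + 3) + C ((e + 3 : ℕ) : ℤ) * h :=
    familyPoly_of_coeff_zero _ (by simp [hh])
  have hg : familyDeriv (e + 3) h =
      X ^ (e + 2) + (C (r : ℤ) - C ((e + 2 : ℕ) : ℤ) * X ^ (e + 1)) := by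
    rw [familyDeriv, hh, derivative_sub, derivative_C_mul, derivative_X, mul_one, derivative_X_pow]
    rfl
  have hC : (C (r : ℤ)).map (Int.castRingHom (ZMod r)) = 0 := by
    rw [map_C, eq_intCast, Int.cast_natCast, CharP.cast_eq_zero, C_0]
  refine ⟨r, (le_max_left _ _).trans_lt hrB, hr, h, ?_, ?_, ?_, ?_, ?_, ?_, ?_⟩
  · refine (degree_sub_le _ _).trans_lt (max_lt ((degree_C_mul_X_le _).trans_lt ?_) ?_)
    · exact_mod_cast (by omega : 1 < e + 3)
    · rw [degree_X_pow]
      exact_mod_cast (by omega : e + 2 < e + 3)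
  · have h1 : familyPoly (e + 3) h = X ^ (e + 3 - 1) * (X - C ((e + 3 : ℕ) : ℤ)) +
        C (r : ℤ) * (C ((e + 3 : ℕ) : ℤ) * X) := by
      rw [hf, hh, show e + 3 - 1 = e + 2 by omega]
      ring
    rw [h1, Polynomial.map_add]
    simp only [Polynomial.map_mul, hC, zero_mul, add_zero]
  · have h1 : familyDeriv (e + 3) h = X ^ (e + 3 - 2) * (X - C (((e + 3 : ℕ) : ℤ) - 1)) +
        C (r : ℤ) := by
      rw [hg, show e + 3 - 2 = e + 1 by omega,
        show ((e + 3 : ℕ) : ℤ) - 1 = ((e + 2 : ℕ) : ℤ) by push_cast; ring]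
      ring
    rw [h1, Polynomial.map_add, hC, add_zero]
  · exact_mod_cast Nat.not_dvd_of_pos_of_lt (by omega) hrd
  · rw [show ((e + 3 : ℕ) : ℤ) - 1 = ((e + 2 : ℕ) : ℤ) by push_cast; ring]
    exact_mod_cast Nat.not_dvd_of_pos_of_lt (by omega) (by omega)
  · rw [hf, hh]
    simp [coeff_X_pow]
  · rw [hg]
    simpa [coeff_X_pow] using hr.not_sq_dvd_self

/-- The examples are `X ^ 2 + p` for `d = 3` and `X ^ 2 * (X ^ (d - 3) + 3) + p` otherwise; `p > 3 *
d` keeps `3` and `d - 3` nonzero modulo `p`. -/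
theorem exists_swapAt_familyDeriv {d : ℕ} (hd : 3 ≤ d) (B : ℕ) :
    ∃ p : ℕ, B < p ∧ p.Prime ∧ ∃ h : ℤ[X], h.degree < d ∧ SwapAt (familyDeriv d h) p := by
  obtain ⟨p, hpB, hp⟩ := Nat.exists_infinite_primes (max B (3 * d) + 1)
  have hpd : 3 * d < p := (le_max_right _ _).trans_lt hpB
  have hC : (C (p : ℤ)).map (Int.castRingHom (ZMod p)) = 0 := by
    rw [map_C, eq_intCast, Int.cast_natCast, CharP.cast_eq_zero, C_0]
  have : Fact p.Prime := ⟨hp⟩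
  refine ⟨p, (le_max_left _ _).trans_lt hpB, hp, ?_⟩
  obtain rfl | hd4 := hd.eq_or_lt
  · have hg : familyDeriv 3 (C (p : ℤ) * X) = X ^ 2 + C (p : ℤ) := by
      rw [familyDeriv, derivative_C_mul, derivative_X, mul_one]
    refine ⟨C (p : ℤ) * X, (degree_C_mul_X_le _).trans_lt (by norm_num), 1, ?_, separable_one,
      by simp, ?_⟩
    · rw [hg, Polynomial.map_add, hC]
      simp
    · rw [hg]
      simpa [coeff_X_pow] using hp.not_sq_dvd_self
  · obtain ⟨e, rfl⟩ : ∃ e, d = e + 4 := ⟨d - 4, by omega⟩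
    have hg : familyDeriv (e + 4) (X ^ 3 + C (p : ℤ) * X) =
        X ^ 2 * (X ^ (e + 1) + C 3) + C (p : ℤ) := by
      rw [familyDeriv, derivative_add, derivative_C_mul, derivative_X, mul_one, derivative_X_pow,
        show e + 4 - 1 = e + 3 by omega]
      push_cast
      ring_nf
    have h3 : (3 : ZMod p) ≠ 0 := by
      have : ((3 : ℕ) : ZMod p) ≠ 0 := by
        rw [Ne, ZMod.natCast_eq_zero_iff]
        exact Nat.not_dvd_of_pos_of_lt (by omega) (by omega)
      exact_mod_cast this
    refine ⟨X ^ 3 + C (p : ℤ) * X, ?_, X ^ (e + 1) - C (-3), ?_, ?_, ?_, ?_⟩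
    · refine (degree_add_le _ _).trans_lt (max_lt ?_ ((degree_C_mul_X_le _).trans_lt ?_))
      · rw [degree_X_pow]
        exact_mod_cast (by omega : 3 < e + 4)
      · exact_mod_cast (by omega : 1 < e + 4)
    · rw [hg, Polynomial.map_add, hC, add_zero, Polynomial.map_mul, C_neg, sub_neg_eq_add]
      simp [map_ofNat C]
    · refine separable_X_pow_sub_C _ ?_ (neg_ne_zero.2 h3)
      rw [Ne, ZMod.natCast_eq_zero_iff]
      exact Nat.not_dvd_of_pos_of_lt (by omega) (by omega)
    · simpa using h3
    · rw [hg]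
      simpa [coeff_X_pow] using hp.not_sq_dvd_self

/-- The translation parameter `t` is unrestricted because `lowerPart` does not scale the constant
term by `d`. -/
theorem exists_swapAt_compIterate_family {d : ℕ} (hd : 2 ≤ d) (m B : ℕ) :
    ∃ p : ℕ, B < p ∧ p.Prime ∧ ∃ h : ℤ[X], h.degree < d ∧
      SwapAt (compIterate (familyPoly d h) (familyDeriv d h) (m + 1)) p := by
  obtain rfl | hd3 := hd.eq_or_lt
  · obtain ⟨p, hpB, hp, t, ht⟩ := exists_swapAt_quadratic m B
    refine ⟨p, hpB, hp, C t, degree_C_le.trans_lt (by norm_num), ?_⟩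
    have hf : familyPoly 2 (C t) = X ^ 2 + C t := by
      rw [familyPoly, lowerPart, coeff_C_zero, sub_self, mul_zero, add_zero]
    have hg : familyDeriv 2 (C t) = X := by
      rw [familyDeriv, derivative_C, add_zero, pow_one]
    rwa [hf, hg]
  · obtain ⟨b, p, hpB, hp, t, ht⟩ := exists_swapAt_trinomial hd3 m B
    have h0 : (C b * X ^ 2 + C t : ℤ[X]).coeff 0 = t := by
      rw [coeff_add, coeff_C_mul_X_pow, if_neg (by norm_num), zero_add, coeff_C_zero]
    refine ⟨p, hpB, hp, C b * X ^ 2 + C t, ?_, ?_⟩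
    · refine (degree_add_le _ _).trans_lt (max_lt ((degree_C_mul_X_pow_le _ _).trans_lt ?_)
        (degree_C_le.trans_lt ?_))
      · exact_mod_cast hd3
      · exact_mod_cast (by omega : 0 < d)
    have hf : familyPoly d (C b * X ^ 2 + C t) = X ^ d + C (d * b) * X ^ 2 + C t := by
      rw [familyPoly, lowerPart, h0, C_mul]
      ring
    have hg : familyDeriv d (C b * X ^ 2 + C t) = X ^ (d - 1) + C (2 * b) * X := by
      rw [familyDeriv, derivative_add, derivative_C, derivative_C_mul_X_pow, add_zero]
      norm_num [mul_comm]
    rwa [hf, hg]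

theorem holdsOnResidueClass_swapAt {d : ℕ} (hd : 2 ≤ d) {D : ℤ} (hD : D ≠ 0) (m : ℕ) :
    HoldsOnResidueClass d fun h => (m = 0 → 3 ≤ d) → ∃ p : ℕ, p.Prime ∧ ¬ (p : ℤ) ∣ D ∧
      SwapAt (compIterate (familyPoly d h) (familyDeriv d h) m) p := by
  by_cases hm : m = 0 → 3 ≤ d
  swap
  · exact holdsOnResidueClass_of_forall fun h h' => absurd h' hm
  refine (holdsOnResidueClass_of_prime (P := fun p h =>
    SwapAt (compIterate (familyPoly d h) (familyDeriv d h) m) p)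
    (fun p h h' hh hp => hp.congr ?_) (fun B => ?_) hD).mono fun h hh _ => hh
  · have := C_dvd_compIterate_sub (N := p ^ 2)
      (by exact_mod_cast C_dvd_familyPoly_sub hh d) (by exact_mod_cast C_dvd_familyDeriv_sub hh d) m
    exact_mod_cast this
  · cases m with
    | zero => simpa [compIterate] using exists_swapAt_familyDeriv (hm rfl) B
    | succ m => exact exists_swapAt_compIterate_family hd m B

end Examples

/-! ### Zariski density and conclusion. -/

/-- The coefficients vary independently in infinite arithmetic progressions, and a polynomial
vanishing on a product of infinite sets is zero. -/
theorem zariskiDense_lowerPart {K : Type*} [Field K] [CharZero K] {d : ℕ} (hd : d ≠ 0) {N : ℕ}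
    (hN : N ≠ 0) {h₀ : ℤ[X]} (h₀d : h₀.degree < d) :
    ZariskiDense {c : Fin d → K | ∃ h : ℤ[X], h.degree < d ∧ C (N : ℤ) ∣ h - h₀ ∧
      ∀ i : Fin d, c i = ((lowerPart d h).coeff i : K)} := by
  intro P hP
  by_contra! hcon
  refine hP (MvPolynomial.funext_set (fun i : Fin d => {x : K | ∃ b : ℤ, (N : ℤ) ∣ b - h₀.coeff i ∧
    x = (((if (i : ℕ) = 0 then 1 else (d : ℤ)) * b : ℤ) : K)}) (fun i => ?_) fun x hx => ?_)
  · refine Set.infinite_of_injective_forall_mem (f := fun k : ℤ =>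
      (((if (i : ℕ) = 0 then 1 else (d : ℤ)) * (h₀.coeff i + N * k) : ℤ) : K)) ?_
      fun k => ⟨_, by simp, rfl⟩
    have hu : (if (i : ℕ) = 0 then 1 else (d : ℤ)) ≠ 0 := by
      split_ifs
      · exact one_ne_zero
      · exact_mod_cast hd
    intro k l hkl
    have h1 := mul_left_cancel₀ hu (Int.cast_injective (α := K) hkl)
    exact mul_left_cancel₀ (by exact_mod_cast hN) (add_left_cancel h1)
  · choose b hb hxb using fun i => hx i (Set.mem_univ i)
    rw [map_zero]
    set h : ℤ[X] := ∑ i : Fin d, C (b i) * X ^ (i : ℕ) with hh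
    have hcoeff : ∀ i : Fin d, h.coeff i = b i := fun i => by
      rw [hh, finsetSum_coeff, Finset.sum_eq_single i]
      · simp
      · intro j _ hj
        rw [coeff_C_mul_X_pow, if_neg fun h => hj (Fin.ext h.symm)]
      · simp
    have hdeg : h.degree < d := degree_sum_fin_lt b
    refine hcon x ⟨h, hdeg, (C_dvd_iff_dvd_coeff _ _).2 fun i => ?_, fun i => ?_⟩
    · rw [coeff_sub]
      by_cases hi : i < d
      · rw [hcoeff ⟨i, hi⟩]
        exact hb ⟨i, hi⟩
      · have hle : ((d : ℕ) : WithBot ℕ) ≤ i := by exact_mod_cast not_lt.1 hi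
        rw [coeff_eq_zero_of_degree_lt (hdeg.trans_le hle),
          coeff_eq_zero_of_degree_lt (h₀d.trans_le hle), sub_zero]
        exact dvd_zero _
    · rw [hxb, coeff_lowerPart, hcoeff]

theorem monicOfCoeffs_lowerPart {K : Type*} [Field K] {d : ℕ} (hd : d ≠ 0) {h : ℤ[X]}
    (hh : h.degree < d) :
    monicOfCoeffs (fun i : Fin d => ((lowerPart d h).coeff i : K)) =
      (familyPoly d h).map (Int.castRingHom K) := by
  have h1 : (lowerPart d h).natDegree < d := by
    by_cases h0 : lowerPart d h = 0
    · rw [h0, natDegree_zero]; omega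
    · exact (natDegree_lt_iff_degree_lt h0).2 (degree_lowerPart_lt hd hh)
  rw [familyPoly, Polynomial.map_add, Polynomial.map_pow, map_X, monicOfCoeffs]
  conv_rhs => rw [as_sum_range_C_mul_X_pow' _ h1]
  rw [Polynomial.map_sum, Fin.sum_univ_eq_sum_range
    (fun i => C (((lowerPart d h).coeff i : ℤ) : K) * X ^ i)]
  simp

theorem derivCompIterate_familyPoly {K : Type*} [Field K] (d n : ℕ) (h : ℤ[X]) :
    derivCompIterate ((familyPoly d h).map (Int.castRingHom K)) n =
      C (d : K) * (compIterate (familyPoly d h) (familyDeriv d h) n).map (Int.castRingHom K) := by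
  rw [derivCompIterate, derivative_map, derivative_familyPoly, map_compIterate, compIterate,
    Polynomial.map_mul, mul_comp, map_C, C_comp, eq_intCast, Int.cast_natCast]

theorem corollary3p6 {K : Type*} [Field K] [NumberField K] (d n : ℕ) (hd : 1 < d) :
    ∃ H : Set (Fin d → K), ZariskiDense H ∧
      ∀ c ∈ H, Nonempty
        ((derivCompIterate (monicOfCoeffs c) n).Gal ≃*
          SymWreath (d - 1) (iteratedSymWreath d n)) := by
  have hD := NumberField.discr_ne_zero K
  have hdouble : HoldsOnResidueClass d fun h => 3 ≤ d → ∃ r : ℕ, r.Prime ∧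
      ¬ (r : ℤ) ∣ discr K ∧ DoublyTransitiveAt d (familyPoly d h) (familyDeriv d h) r := by
    by_cases h3 : 3 ≤ d
    · exact (holdsOnResidueClass_doublyTransitiveAt h3 hD).mono fun h hh _ => hh
    · exact holdsOnResidueClass_of_forall fun h h' => absurd h' h3
  -- All conditions are now combined, so the lower bound on the primes can be `0`.
  obtain ⟨N, hN, -, h₀, h₀d, hP⟩ := ((holdsOnResidueClass_transitiveAt hd hD).and (hdouble.and
    (HoldsOnResidueClass.forall_le (holdsOnResidueClass_swapAt hd hD) n))) 0
  refine ⟨_, zariskiDense_lowerPart (by omega) hN h₀d, ?_⟩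
  rintro c ⟨h, hh, hhN, hc⟩
  obtain ⟨h1, h2, h3⟩ := hP h hhN
  obtain ⟨hf, hfd⟩ := monic_familyPoly (show d ≠ 0 by omega) hh
  obtain ⟨hg, hgd⟩ := monic_familyDeriv hd hh
  rw [show c = _ from funext hc, monicOfCoeffs_lowerPart (by omega) hh]
  set Φ := derivCompIterate ((familyPoly d h).map (Int.castRingHom K)) n with hΦ
  have : NumberField Φ.SplittingField := NumberField.of_module_finite K _
  have : IsGalois K Φ.SplittingField := ⟨⟩
  set γ := (compIterate (familyPoly d h) (familyDeriv d h) n).map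
    (Int.castRingHom Φ.SplittingField) with hγ
  -- `f' ∘ f^n` and the monic `g ∘ f^n` differ by the unit `d`, so they have the same roots.
  have hmap : Φ.map (algebraMap K Φ.SplittingField) = C (d : Φ.SplittingField) * γ := by
    have h4 := congrArg (Polynomial.map (algebraMap K Φ.SplittingField))
      (derivCompIterate_familyPoly d n h)
    rwa [← hΦ, Polynomial.map_mul, map_C, Polynomial.map_map,
      Subsingleton.elim ((algebraMap K Φ.SplittingField).comp (Int.castRingHom K))
        (Int.castRingHom _), map_natCast] at h4
  have hd0 : (d : Φ.SplittingField) ≠ 0 := by exact_mod_cast (by omega : d ≠ 0)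
  have hγ0 : γ ≠ 0 := ((monic_compIterate hf hg (by omega) n).map _).ne_zero
  have hne : Φ.map (algebraMap K Φ.SplittingField) ≠ 0 := by
    rw [hmap]
    exact mul_ne_zero (C_ne_zero.2 hd0) hγ0
  refine nonempty_gal_mulEquiv_symWreath hd hf hg hfd hgd ?_ ?_ h1 h2 h3
  · exact (SplittingField.splits Φ).of_dvd hne (by rw [hmap]; exact dvd_mul_left _ _)
  · have hroot : {x : Φ.SplittingField | γ.eval x = 0} = Φ.rootSet Φ.SplittingField := by
      ext x
      rw [mem_rootSet', and_iff_right hne, Set.mem_ofPred_eq, ← eval_map_algebraMap, hmap,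
        eval_mul, eval_C, mul_eq_zero, or_iff_right hd0]
    rw [← hγ, hroot]
    exact IntermediateField.adjoin_eq_top_of_algebra K _ (SplittingField.adjoin_rootSet Φ)
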